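/- **Setting.** Ambient isotopies of $X=\mathbb R^3,\mathbb R^4$ are continuous families of homeomorphisms $H_u$ of $X$, $u\in[0,1]$, with $H_0=\mathrm{id}$; sets $A,B\subseteq X$ are ambient isotopic if $H_1(A)=B$ for one of them. A *polynomial knot* is an embedding $t\mapsto(f(t),g(t),h(t))$ of $\mathbb R$ in $\mathbb R^3$ (injective, with nowhere vanishing derivative) with $f,g,h\in\mathbb R[t]$. A *long 2-knot* is a proper smooth embedding $\mathbb R^2\to\mathbb R^4$ equal to $(x,y)\mapsto(x,y,0,0)$ outside a compact set; a *polynomial 2-knot* is a proper smooth embedding $\mathbb R^2\to\mathbb R^4$ with polynomial coordinates whose image is ambient isotopic to the image of a long 2-knot. The *spin* of a subset $k$ of $\{(x,y,z)\in\mathbb R^3: z\ge 0\}$ is $\{(x,y,z\cos\theta,z\sin\theta) : (x,y,z)\in k,\ 0\le\theta\le2\pi\}\subset\mathbb R^4$. The *Chebyshev approximation* of degree $n\geq 1$ of a function on $[\alpha,\beta]$ is the polynomial of degree at most $n$ that interpolates it in the $n+1$ Chebyshev points $\frac{\alpha+\beta}2-\frac{\beta-\alpha}2\cos\frac{j\pi}n$,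 $0\le j\le n$. **Theorem 5 (Construction II).** Let $K=\{(f(t),g(t),h(t)): t\in\mathbb R\}$ be a polynomial knot. Then there are $f_1,g_1,h_1\in\mathbb R[t]$, $a\in\mathbb R$ and a polynomial 2-knot $P:\mathbb R^2\to\mathbb R^4$ with the following properties. 1. (*Knotted arc of $K$ with one end at infinity.*) $(f_1,g_1,h_1)$ is a polynomial knot whose image is ambient isotopic to $K$. Moreover $h_1(a)=0$, $h_1'(a)\ne0$, $h_1(t)>0$ for $t>a$ and $h_1(t)\to\infty$ as $t\to\infty$, so that the arc $k=\{(f_1(t),g_1(t),h_1(t)): t\ge a\}$ lies in the upper half space, meets the plane $z=0$ transversely and in its endpoint only, and goes to infinity. The union of $k$ and the vertical ray $\{(f_1(a),g_1(a),z): z\le 0\}$ is ambient isotopic to $K$. 2. (*Spinning.*) The spin of $k$ is ambient isotopic in $\mathbb R^4$ to the image of $P$. 3. (*Polynomial parametrization.*) For every $\varepsilon>0$ there is an $N$ such that for all $n\ge N$ the Chebyshev approximations $S$ and $C$ of degree $n$ of $\sin$ and $\cos$ on $[0,2\pi]$ satisfy $|S(s)-\sin s|<\varepsilon$ and $|C(s)-\cos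 s|<\varepsilon$ for all $s\in[0,2\pi]$, and the map $$\psi':[a,\infty)\times[0,2\pi]\to\mathbb R^4,\qquad \psi'(t,s)=\bigl(f_1(t),\,g_1(t),\,h_1(t)S(s),\,h_1(t)C(s)\bigr)$$ parametrizes this knotted plane: $\psi'(t,s)=\psi'(t',s')$ if and only if $t=t'$ and ($t=a$ or $s=s'$ or $\{s,s'\}=\{0,2\pi\}$), and the image of $\psi'$ is ambient isotopic in $\mathbb R^4$ to the spin of $k$ (and hence to the image of $P$). -/

import Mathlib

open Polynomial Set Filter Topology
open scoped ContDiff unitInterval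

noncomputable section

/-- Two subsets `A`, `B` of a space `X` are ambient isotopic: there is a continuous family of
homeomorphisms of `X`, indexed by `[0,1]` and starting at the identity, whose last member carries
`A` onto `B`. -/
def AmbientIsotopic {X : Type*} [TopologicalSpace X] (A B : Set X) : Prop :=
  ∃ H : I × X → X, Continuous H ∧ (∀ u : I, IsHomeomorph fun x => H (u, x)) ∧
    (∀ x, H (0, x) = x) ∧ (fun x => H (1, x)) '' A = B

/-- The curve `t ↦ (f t, g t, h t)` in `ℝ³`. -/
def polyCurve (f g h : ℝ[X]) (t : ℝ) : EuclideanSpace ℝ (Fin 3) :=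
  !₂[f.eval t, g.eval t, h.eval t]

/-- `(f, g, h)` is a polynomial knot: `t ↦ (f t, g t, h t)` is an embedding of `ℝ` in `ℝ³`, that is,
injective with nowhere vanishing derivative (properness is automatic for polynomials). -/
structure IsPolynomialKnot (f g h : ℝ[X]) : Prop where
  injective : Function.Injective (polyCurve f g h)
  immersion : ∀ t : ℝ, polyCurve (derivative f) (derivative g) (derivative h) t ≠ 0

/-- The arc `{(f t, g t, h t) | a ≤ t}`. -/
def polyArc (f g h : ℝ[X]) (a : ℝ) : Set (EuclideanSpace ℝ (Fin 3)) :=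
  polyCurve f g h '' Ici a

/-- The vertical ray that leaves the point `p` downwards (in the direction of the negative third
axis). -/
def downwardRay (p : EuclideanSpace ℝ (Fin 3)) : Set (EuclideanSpace ℝ (Fin 3)) :=
  {q | q 0 = p 0 ∧ q 1 = p 1 ∧ q 2 ≤ p 2}

/-- The arc `t ↦ (f t, g t, h t)`, `a ≤ t`, of the polynomial knot `(f, g, h)` lies in the upper
half space `{z ≥ 0}`, meets the boundary plane `{z = 0}` only in its endpoint and transversely
there, and goes to infinity at the other end. -/
structure IsHalfSpaceArc (f g h : ℝ[X]) (a : ℝ) : Prop where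
  knot : IsPolynomialKnot f g h
  endpoint : h.eval a = 0
  positive : ∀ t : ℝ, a < t → 0 < h.eval t
  transverse : (derivative h).eval a ≠ 0
  infinite : Tendsto (fun t : ℝ => h.eval t) atTop atTop

/-- A half space arc is a knotted arc of the long knot `K ⊆ ℝ³`: it belongs to a polynomial
representation of the knot type of `K`, and it carries the whole of the knot, in the sense that
closing it off below the boundary plane by a straight ray gives the knot type of `K` again. -/
structure IsKnottedArcOf (f g h : ℝ[X]) (a : ℝ) (K : Set (EuclideanSpace ℝ (Fin 3))) : Prop where
  arc : IsHalfSpaceArc f g h a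
  representation : AmbientIsotopic (range (polyCurve f g h)) K
  closing : AmbientIsotopic (polyArc f g h a ∪ downwardRay (polyCurve f g h a)) K

/-- The surface swept out by a subset `k` of the upper half space `{(x, y, z, 0) | z ≥ 0}` that is
rotated in `ℝ⁴` by the full angle about the plane `{(x, y, 0, 0)}`. -/
def spin (k : Set (EuclideanSpace ℝ (Fin 3))) : Set (EuclideanSpace ℝ (Fin 4)) :=
  {q | ∃ p ∈ k, ∃ θ ∈ Icc (0 : ℝ) (2 * Real.pi),
    q = !₂[p 0, p 1, p 2 * Real.cos θ, p 2 * Real.sin θ]}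

/-- The map `(t, s) ↦ (f t, g t, h t * S s, h t * C s)`. -/
def spinParam (f g h S C : ℝ[X]) (x : ℝ × ℝ) : EuclideanSpace ℝ (Fin 4) :=
  !₂[f.eval x.1, g.eval x.1, h.eval x.1 * S.eval x.2, h.eval x.1 * C.eval x.2]

/-- A smooth embedding: a smooth immersion that is a proper embedding (a homeomorphism onto a closed
subset). -/
structure IsProperSmoothEmbedding
    (φ : EuclideanSpace ℝ (Fin 2) → EuclideanSpace ℝ (Fin 4)) : Prop where
  smooth : ContDiff ℝ ∞ φ
  immersion : ∀ x, Function.Injective (fderiv ℝ φ x)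
  proper : IsClosedEmbedding φ

/-- A long 2-knot: a proper smooth embedding of `ℝ²` in `ℝ⁴` that is the standard one outside a
compact region. -/
structure IsLongTwoKnot
    (φ : EuclideanSpace ℝ (Fin 2) → EuclideanSpace ℝ (Fin 4)) : Prop where
  embedding : IsProperSmoothEmbedding φ
  standard : ∃ D : Set (EuclideanSpace ℝ (Fin 2)), IsCompact D ∧
    ∀ x, x ∉ D → φ x = !₂[x 0, x 1, 0, 0]

/-- A polynomial 2-knot: a proper smooth embedding of `ℝ²` in `ℝ⁴` with polynomial coordinates that
represents a long 2-knot, up to ambient isotopy (a polynomial map that agrees with the standard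
embedding near infinity would be the standard embedding). -/
structure IsPolynomialTwoKnot
    (φ : EuclideanSpace ℝ (Fin 2) → EuclideanSpace ℝ (Fin 4)) : Prop where
  polynomial : ∃ p : Fin 4 → MvPolynomial (Fin 2) ℝ,
    ∀ x i, φ x i = MvPolynomial.eval (fun j => x j) (p i)
  embedding : IsProperSmoothEmbedding φ
  long : ∃ L, IsLongTwoKnot L ∧ AmbientIsotopic (range φ) (range L)

/-- The `j`-th of the `n + 1` Chebyshev points (of the second kind, so the endpoints are among them)
of the interval `[α, β]`, in increasing order: the affine images of the extremal points
`cos (j π / n)` of the Chebyshev polynomial of degree `n`; meant for `n ≥ 1` and `0 ≤ j ≤ n`. -/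
def chebyshevPoint (α β : ℝ) (n j : ℕ) : ℝ :=
  (α + β) / 2 - (β - α) / 2 * Polynomial.Chebyshev.node n j

/-- The Chebyshev approximation of degree `n` of a function `u` on `[α, β]`: the polynomial of
degree at most `n` that interpolates `u` in the `n + 1` Chebyshev points of the interval. -/
def chebyshevApprox (u : ℝ → ℝ) (α β : ℝ) (n : ℕ) : ℝ[X] :=
  Lagrange.interpolate (Finset.range (n + 1)) (chebyshevPoint α β n)
    (fun j => u (chebyshevPoint α β n j))

end

/-!
After a generic linear change of coordinates `(f, g)` has finitely many crossings, and only the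
values of the third coordinate at their parameters matter for the knot type. So the third coordinate
may be any `(X - a) m²` that interpolates `h`, up to a constant, at these parameters, where `a` lies
below all of them and `m > 0`. With `t = ‖x‖² + a` the spun arc then has a polynomial
parametrization, as the surface of revolution with profile `√(t - a) m(t)`, and flattening the
profile near infinity makes it a long 2-knot. Approximations of sine and cosine that are exact at
the endpoints and close in Lipschitz norm merely distort the spinning circles radially and
reparametrize them, which moves the spun surface by an ambient isotopy.
-/

/-! ### Ambient isotopies -/

namespace AmbientIsotopic

section TopologicalSpace

variable {X Y : Type*} [TopologicalSpace X] [TopologicalSpace Y] {A B C : Set X}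

theorem trans (hAB : AmbientIsotopic A B) (hBC : AmbientIsotopic B C) : AmbientIsotopic A C := by
  obtain ⟨H, hH, hHhom, hH0, rfl⟩ := hAB
  obtain ⟨K, hK, hKhom, hK0, rfl⟩ := hBC
  exact ⟨fun p => K (p.1, H p), by fun_prop, fun u => (hKhom u).comp (hHhom u),
    fun x => by simp only [hH0, hK0], by rw [image_image]⟩

theorem symm (hAB : AmbientIsotopic A B) : AmbientIsotopic B A := by
  obtain ⟨H, hH, hHhom, hH0, rfl⟩ := hAB
  let e : X ≃ₜ X := (hHhom 1).homeomorph
  have he : ∀ x, H (1, x) = e x := fun _ => rfl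
  refine ⟨fun p => H (unitInterval.symm p.1, e.symm p.2), by fun_prop,
    fun u => (hHhom (unitInterval.symm u)).comp e.symm.isHomeomorph, fun x => ?_, ?_⟩
  · simp only [unitInterval.symm_zero, he, e.apply_symm_apply]
  · simp only [image_image, unitInterval.symm_one, hH0, he, e.symm_apply_apply, image_id']

theorem image_homeomorph (e : X ≃ₜ Y) (hAB : AmbientIsotopic A B) :
    AmbientIsotopic (e '' A) (e '' B) := by
  obtain ⟨H, hH, hHhom, hH0, rfl⟩ := hAB
  refine ⟨fun p => e (H (p.1, e.symm p.2)), by fun_prop,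
    fun u => e.isHomeomorph.comp ((hHhom u).comp e.symm.isHomeomorph), fun y => ?_, ?_⟩
  · simp only [hH0, e.apply_symm_apply]
  · simp only [image_image, e.symm_apply_apply]

end TopologicalSpace

theorem image_add_shear {V : Type*} [AddCommGroup V] [Module ℝ V] [TopologicalSpace V]
    [IsTopologicalAddGroup V] [ContinuousSMul ℝ V] {e : V → V} (he : Continuous e)
    (hinv : ∀ (c : ℝ) x, e (x + c • e x) = e x) (A : Set V) :
    AmbientIsotopic A ((fun x => x + e x) '' A) := by
  let shear (c : ℝ) : V ≃ₜ V :=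
    { toFun := fun x => x + c • e x
      invFun := fun x => x + (-c) • e x
      left_inv := fun x => by
        dsimp only
        rw [hinv, neg_smul, add_neg_cancel_right]
      right_inv := fun x => by
        dsimp only
        rw [hinv, neg_smul, neg_add_cancel_right]
      continuous_toFun := by fun_prop
      continuous_invFun := by fun_prop }
  exact ⟨fun p => p.2 + (p.1 : ℝ) • e p.2, by fun_prop, fun u => (shear u).isHomeomorph,
    by simp, by simp⟩

theorem image_add_contraction {V : Type*} [NormedAddCommGroup V] [NormedSpace ℝ V]
    [CompleteSpace V] {e : V → V} {K : NNReal} (hK : K < 1) (he : LipschitzWith K e) (A : Set V) :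
    AmbientIsotopic A ((fun x => x + e x) '' A) := by
  have happrox (u : I) : ApproximatesLinearOn (fun x => x + (u : ℝ) • e x)
      ((ContinuousLinearEquiv.refl ℝ V : V ≃L[ℝ] V) : V →L[ℝ] V) univ K := by
    intro x _ y _
    calc ‖x + (u : ℝ) • e x - (y + (u : ℝ) • e y) - (x - y)‖
        = ‖(u : ℝ) • (e x - e y)‖ := by rw [smul_sub]; congr 1; abel
      _ = u * ‖e x - e y‖ := by rw [norm_smul, Real.norm_of_nonneg u.2.1]
      _ ≤ 1 * ‖e x - e y‖ := by gcongr; exact u.2.2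
      _ ≤ K * ‖x - y‖ := by simpa using he.norm_sub_le x y
  have hsmall : Subsingleton V ∨ K < ‖((ContinuousLinearEquiv.refl ℝ V).symm : V →L[ℝ] V)‖₊⁻¹ := by
    rcases subsingleton_or_nontrivial V with hV | hV
    · exact Or.inl hV
    · exact Or.inr (by simpa using hK)
  have := he.continuous
  exact ⟨fun p => p.2 + (p.1 : ℝ) • e p.2, by fun_prop,
    fun u => ((happrox u).toHomeomorph _ hsmall).isHomeomorph, by simp, by simp⟩

end AmbientIsotopic

section ContinuousFactor

universe u w

theorem exists_continuous_factor {T : Type*} {Y : Type u} {W : Type w} [TopologicalSpace T]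
    [TopologicalSpace Y] [NormalSpace Y] [TopologicalSpace W] [TietzeExtension.{u, w} W]
    {π : T → Y} (hπ : Continuous π) (hcl : IsClosedMap π) {δ : T → W} (hδ : Continuous δ)
    (hfac : ∀ s t, π s = π t → δ s = δ t) :
    ∃ φ : Y → W, Continuous φ ∧ ∀ t, φ (π t) = δ t := by
  let p : C(T, range π) := ⟨rangeFactorization π, hπ.rangeFactorization⟩
  have hp : IsQuotientMap p := by
    refine IsClosedMap.isQuotientMap ?_ p.continuous rangeFactorization_surjective
    exact hcl.codRestrict mem_range_self
  have hfac' : ∀ s t, p s = p t → δ s = δ t := fun s t hst => hfac s t (congrArg Subtype.val hst)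
  obtain ⟨Φ, hΦ⟩ := ContinuousMap.exists_restrict_eq hcl.isClosed_range (hp.lift ⟨δ, hδ⟩ hfac')
  exact ⟨Φ, Φ.continuous, fun t =>
    (DFunLike.congr_fun hΦ (p t)).trans (DFunLike.congr_fun (hp.lift_comp ⟨δ, hδ⟩ hfac') t)⟩

end ContinuousFactor

namespace AmbientIsotopic

section Prod

variable {V W : Type*} [NormedAddCommGroup V] [NormedSpace ℝ V]
  [NormedAddCommGroup W] [NormedSpace ℝ W]

theorem image_shear_snd {φ : V → W} (hφ : Continuous φ) (A : Set (V × W)) :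
    AmbientIsotopic A ((fun p => (p.1, p.2 + φ p.1)) '' A) := by
  simpa [Prod.add_def] using
    image_add_shear (e := fun p : V × W => (0, φ p.1)) (by fun_prop) (by simp) A

theorem image_shear_fst {φ : W → V} (hφ : Continuous φ) (A : Set (V × W)) :
    AmbientIsotopic A ((fun p => (p.1 + φ p.2, p.2)) '' A) := by
  simpa [Prod.add_def] using
    image_add_shear (e := fun p : V × W => (φ p.2, 0)) (by fun_prop) (by simp) A

-- The difference of the heights factors through the projection, and the factor extends to `V`.
theorem range_prodMk [FiniteDimensional ℝ W] {T : Type*} [TopologicalSpace T] {π : T → V}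
    (hπ : Continuous π) (hcl : IsClosedMap π) {δ δ' : T → W} (hδ : Continuous δ)
    (hδ' : Continuous δ') (hfac : ∀ s t, π s = π t → δ' s - δ s = δ' t - δ t) :
    AmbientIsotopic (range fun t => (π t, δ t)) (range fun t => (π t, δ' t)) := by
  have : TietzeExtension W := TietzeExtension.of_tvs ℝ
  obtain ⟨φ, hφ, hφδ⟩ := exists_continuous_factor hπ hcl (hδ'.sub hδ) hfac
  simpa [← range_comp, Function.comp_def, hφδ] using image_shear_snd hφ (range fun t => (π t, δ t))

theorem image_rotate (A : Set (V × V)) :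
    AmbientIsotopic A ((fun p => (-p.2, p.1)) '' A) := by
  have h₁ := image_shear_snd continuous_id A
  have h₂ := h₁.trans (image_shear_fst continuous_neg _)
  have h₃ := h₂.trans (image_shear_snd continuous_id _)
  simpa [image_image] using! h₃

end Prod

end AmbientIsotopic

section Radial

variable {V : Type*} [NormedAddCommGroup V] [NormedSpace ℝ V] [ProperSpace V] {c : ℝ → ℝ}

theorem isHomeomorph_norm_smul (hc : Continuous c)
    (hmono : StrictMonoOn (fun r => r * c r) (Ici 0))
    (hlim : Tendsto (fun r => r * c r) atTop atTop) :
    IsHomeomorph fun x : V => c ‖x‖ • x := by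
  have hpos {r : ℝ} (hr : 0 < r) : 0 < c r := by
    have := hmono self_mem_Ici hr.le hr
    exact pos_of_mul_pos_right (by simpa using this) hr.le
  have hnorm (x : V) : ‖c ‖x‖ • x‖ = ‖x‖ * c ‖x‖ := by
    rcases eq_or_ne x 0 with rfl | hx
    · simp
    · rw [norm_smul, Real.norm_of_nonneg (hpos (norm_pos_iff.2 hx)).le, mul_comm]
  have hcont : Continuous fun x : V => c ‖x‖ • x := by fun_prop
  refine isHomeomorph_iff_continuous_isClosedMap_bijective.2 ⟨hcont, ?_, ?_, ?_⟩
  · refine (isProperMap_iff_tendsto_cocompact.2 ⟨hcont, ?_⟩).isClosedMap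
    rw [← Metric.cobounded_eq_cocompact, ← tendsto_norm_atTop_iff_cobounded]
    simpa only [hnorm] using! hlim.comp tendsto_norm_cobounded_atTop
  · intro x y hxy
    dsimp only at hxy
    have hr : ‖x‖ = ‖y‖ := hmono.injOn (norm_nonneg x) (norm_nonneg y) (by
      simpa only [hnorm] using congrArg norm hxy)
    rcases eq_or_ne y 0 with rfl | hy
    · simpa using hr
    · rw [hr] at hxy
      exact smul_right_injective V (hpos (norm_pos_iff.2 hy)).ne' hxy
  · intro y
    rcases eq_or_ne y 0 with rfl | hy
    · exact ⟨0, smul_zero _⟩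
    obtain ⟨r, hr, hry⟩ : ∃ r ∈ Ici (0 : ℝ), r * c r = ‖y‖ := by
      refine mem_image _ _ _ |>.1 (intermediate_value_Ici (by fun_prop) hlim ?_)
      simp
    have hy' : ‖y‖ ≠ 0 := norm_ne_zero_iff.2 hy
    refine ⟨(r / ‖y‖) • y, ?_⟩
    have : ‖(r / ‖y‖) • y‖ = r := by
      rw [norm_smul, norm_div, norm_norm, Real.norm_of_nonneg hr, div_mul_cancel₀ _ hy']
    dsimp only
    rw [this, smul_smul, ← mul_div_assoc, mul_comm (c r), hry, div_self hy', one_smul]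

theorem AmbientIsotopic.image_norm_smul_fst {W : Type*} [TopologicalSpace W] (A : Set (V × W)) :
    AmbientIsotopic A ((fun p => (‖p.1‖ • p.1, p.2)) '' A) := by
  refine ⟨fun q => ((1 - (q.1 : ℝ) + q.1 * ‖q.2.1‖) • q.2.1, q.2.2), by fun_prop, fun u => ?_,
    by simp, by simp⟩
  refine IsHomeomorph.prodMap (f := fun x : V => (1 - (u : ℝ) + u * ‖x‖) • x)
    (isHomeomorph_norm_smul (c := fun r => 1 - u + u * r) (by fun_prop) ?_ ?_) IsHomeomorph.id
  · intro r (hr : 0 ≤ r) s _ hrs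
    obtain ⟨hu₀, hu₁⟩ := u.2
    have hslope : 0 < 1 - (u : ℝ) + u * (s + r) := by
      rcases hu₀.eq_or_lt with hu | hu
      · simp [← hu]
      · have : 0 < u * (s + r) := mul_pos hu (by linarith)
        linarith
    dsimp only
    nlinarith [mul_pos (sub_pos.2 hrs) hslope]
  · refine tendsto_atTop_mono' _ ?_ tendsto_id
    filter_upwards [eventually_ge_atTop 1] with r hr
    have : 0 ≤ (u : ℝ) * (r - 1) := mul_nonneg u.2.1 (sub_nonneg.2 hr)
    exact le_mul_of_one_le_right (zero_le_one.trans hr) (by linarith)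

end Radial

/-! ### Common zeros of bivariate polynomials -/

section CommonAbscissas

open scoped Polynomial.Bivariate

theorem resultant_ne_zero_of_irreducible {R : Type*} [CommRing R] [IsDomain R] [IsGCDMonoid R]
    {Q A : R[X]} (hQ : Irreducible Q) (hdeg : Q.natDegree ≠ 0) (hA : ¬ Q ∣ A) :
    resultant Q A ≠ 0 := by
  let K := FractionRing R
  have hinj : Function.Injective (algebraMap R K) := IsFractionRing.injective _ _
  have hprim := hQ.isPrimitive hdeg
  have hcop : IsCoprime (Q.map (algebraMap R K)) (A.map (algebraMap R K)) := by
    rw [(hprim.irreducible_iff_irreducible_map_fraction_map.1 hQ).coprime_iff_not_dvd]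
    exact fun h => hA (hprim.dvd_of_fraction_map_dvd_fraction_map h)
  have hK := resultant_ne_zero _ _ hcop
  rw [natDegree_map_eq_of_injective hinj, natDegree_map_eq_of_injective hinj,
    resultant_map_map] at hK
  exact ne_zero_of_map hK

theorem eval_resultant_eq_zero {R : Type*} [CommRing R] {Q A : R[X][Y]} (hdeg : Q.natDegree ≠ 0)
    {s t : R} (hQ : Q.evalEval s t = 0) (hA : A.evalEval s t = 0) :
    (resultant Q A).eval s = 0 := by
  obtain ⟨p, q, -, -, hpq⟩ := exists_mul_add_mul_eq_C_resultant (m := Q.natDegree)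
    (n := A.natDegree) Q A le_rfl le_rfl (Or.inl hdeg)
  have := congrArg (evalEval s t) hpq
  rw [evalEval_add, evalEval_mul, evalEval_mul, hQ, hA, evalEval_C] at this
  simpa using this.symm

variable {k : Type*} [Field k]

/-- The abscissas `s` of the common zeros `(s, t)` of two bivariate polynomials; the inner variable
of `k[X][Y]` is the abscissa. -/
def commonAbscissas (A B : k[X][Y]) : Set k :=
  {s | ∃ t, A.evalEval s t = 0 ∧ B.evalEval s t = 0}

theorem commonAbscissas_mul_right (A B Q : k[X][Y]) :
    commonAbscissas A (B * Q) = commonAbscissas A B ∪ commonAbscissas A Q := by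
  ext s
  simp only [commonAbscissas, evalEval_mul, mul_eq_zero, mem_union, mem_ofPred_eq, and_or_left,
    exists_or]

theorem finite_commonAbscissas_of_not_dvd {A Q : k[X][Y]} (hQ : Irreducible Q) (hA : ¬ Q ∣ A) :
    (commonAbscissas A Q).Finite := by
  by_cases hdeg : Q.natDegree = 0
  · obtain ⟨q, rfl⟩ := natDegree_eq_zero.1 hdeg
    refine (q.rootSet_finite k).subset ?_
    rintro s ⟨t, -, hQt⟩
    rw [mem_rootSet]
    exact ⟨by rintro rfl; simp at hQ, by simpa [evalEval_C] using hQt⟩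
  · refine ((resultant Q A).rootSet_finite k).subset ?_
    rintro s ⟨t, hAt, hQt⟩
    rw [mem_rootSet]
    exact ⟨resultant_ne_zero_of_irreducible hQ hdeg hA,
      by simpa using eval_resultant_eq_zero hdeg hQt hAt⟩

theorem dvd_and_dvd_of_dvd_add_CC_mul {F H Q : k[X][Y]} {c d : k} (hcd : c ≠ d)
    (hc : Q ∣ F + CC c * H) (hd : Q ∣ F + CC d * H) : Q ∣ F ∧ Q ∣ H := by
  have hunit : IsUnit (CC (c - d) : k[X][Y]) :=
    ((isUnit_iff_ne_zero.2 (sub_ne_zero.2 hcd)).map C).map C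
  have hH : Q ∣ H := by
    rw [← hunit.dvd_mul_left]
    have hsub : CC (c - d) * H = F + CC c * H - (F + CC d * H) := by
      rw [CC, CC, CC, C_sub, C_sub]
      ring
    exact hsub ▸ dvd_sub hc hd
  exact ⟨(dvd_add_left (hH.mul_left _)).1 hc, hH⟩

variable {F G H : k[X][Y]}

theorem subsingleton_infinite_commonAbscissas (hG : Irreducible G)
    (hFGH : ∀ s t : k, G.evalEval s t = 0 → F.evalEval s t = 0 → H.evalEval s t ≠ 0) :
    {c : k | (commonAbscissas (F + CC c * H) G).Infinite}.Subsingleton := by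
  intro c hc d hd
  by_contra hcd
  have hdvd : ∀ b, (commonAbscissas (F + CC b * H) G).Infinite → G ∣ F + CC b * H := fun b hb =>
    by_contra fun h => hb (finite_commonAbscissas_of_not_dvd hG h)
  obtain ⟨hF, hH⟩ := dvd_and_dvd_of_dvd_add_CC_mul hcd (hdvd c hc) (hdvd d hd)
  obtain ⟨s, t, -, hst⟩ := hc.nonempty
  exact hFGH s t hst (zero_dvd_iff.1 (hst ▸ evalEval_dvd s t hF))
    (zero_dvd_iff.1 (hst ▸ evalEval_dvd s t hH))

theorem finite_infinite_commonAbscissas (hG : G ≠ 0)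
    (hFGH : ∀ s t : k, G.evalEval s t = 0 → F.evalEval s t = 0 → H.evalEval s t ≠ 0) :
    {c : k | (commonAbscissas (F + CC c * H) G).Infinite}.Finite := by
  induction G using UniqueFactorizationMonoid.induction_on_prime with
  | h₁ => exact absurd rfl hG
  | h₂ G hunit =>
    have hempty (A : k[X][Y]) : commonAbscissas A G = ∅ := eq_empty_of_forall_notMem
      fun s ⟨t, _, hst⟩ => (hunit.map (evalEvalRingHom s t)).ne_zero hst
    simp [hempty]
  | h₃ G Q _ hQ ih =>
    have hfinQ := (subsingleton_infinite_commonAbscissas hQ.irreducible fun s t hst =>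
      hFGH s t (by rw [evalEval_mul, hst, zero_mul])).finite
    have hfinG := ih (right_ne_zero_of_mul hG) fun s t hst =>
      hFGH s t (by rw [evalEval_mul, hst, mul_zero])
    simp only [commonAbscissas_mul_right, infinite_union]
    exact hfinQ.union hfinG

end CommonAbscissas

section DividedDiff

open scoped Polynomial.Bivariate

variable {R : Type*} [CommRing R]

/-- The divided difference `(f(Y) - f(X)) / (Y - X)` of a polynomial. -/
noncomputable def dividedDiff (f : R[X]) : R[X][Y] :=
  f.map C /ₘ (Y - C X)

theorem C_add_mul_dividedDiff (f : R[X]) : C f + (Y - C X) * dividedDiff f = f.map C := by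
  have h := modByMonic_add_div (f.map C) ((Y : R[X][Y]) - C X)
  rwa [modByMonic_X_sub_C_eq_C_eval, eval_map, eval₂_C_X] at h

theorem eval_add_mul_dividedDiff (f : R[X]) (s t : R) :
    f.eval s + (t - s) * (dividedDiff f).evalEval s t = f.eval t := by
  simpa [evalEval_C, evalEval_X, evalEval_map_C] using
    congrArg (evalEval s t) (C_add_mul_dividedDiff f)

theorem evalEval_dividedDiff_self (f : R[X]) (s : R) :
    (dividedDiff f).evalEval s s = (derivative f).eval s := by
  simpa [evalEval_C, evalEval_X, evalEval_map_C, derivative_map] using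
    congrArg (fun p => evalEval s s (derivative p)) (C_add_mul_dividedDiff f)

theorem evalEval_dividedDiff_eq_zero_iff [IsDomain R] {f : R[X]} {s t : R} (hst : s ≠ t) :
    (dividedDiff f).evalEval s t = 0 ↔ f.eval s = f.eval t := by
  rw [← eval_add_mul_dividedDiff f s t, left_eq_add, mul_eq_zero, or_iff_right]
  exact sub_ne_zero.2 hst.symm

theorem dividedDiff_add_C_mul [IsDomain R] (f h : R[X]) (c : R) :
    dividedDiff (f + C c * h) = dividedDiff f + CC c * dividedDiff h := by
  apply mul_left_cancel₀ (X_sub_C_ne_zero X : (Y : R[X][Y]) - C X ≠ 0)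
  have hsum := C_add_mul_dividedDiff (f + C c * h)
  simp only [map_add, map_mul, Polynomial.map_add, Polynomial.map_mul, map_C] at hsum ⊢
  linear_combination hsum - C_add_mul_dividedDiff f - C (C c) * C_add_mul_dividedDiff h

theorem dividedDiff_ne_zero {f : R[X]} (hf : 0 < f.degree) : dividedDiff f ≠ 0 := by
  intro h
  have hspec := C_add_mul_dividedDiff f
  rw [h, mul_zero, add_zero] at hspec
  have := congrArg degree hspec
  rw [degree_map_eq_of_injective C_injective] at this
  exact absurd degree_C_le (not_le.2 (this ▸ hf))

end DividedDiff

/-! ### Polynomial interpolation and growth -/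

section Interpolation

theorem exists_eval_eq_and_derivative_eval_eq_zero {k : Type*} [Field k] (D : Finset k)
    (v : k → k) : ∃ p : k[X], ∀ s ∈ D, p.eval s = v s ∧ (derivative p).eval s = 0 := by
  classical
  let p₀ := Lagrange.interpolate D id v
  let w := Lagrange.nodal D (id : k → k)
  let p₁ := Lagrange.interpolate D id fun s => -(derivative p₀).eval s / (derivative w).eval s
  refine ⟨p₀ + w * p₁, fun s hs => ?_⟩
  have hw : w.eval s = 0 := Lagrange.eval_nodal_at_node (v := id) hs
  have hw' : (derivative w).eval s ≠ 0 := by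
    rw [show s = id s from rfl, Lagrange.eval_nodal_derivative_eval_node_eq hs]
    exact Lagrange.eval_nodal_not_at_node fun j hj => (Finset.ne_of_mem_erase hj).symm
  have hp₀ : p₀.eval s = v s := Lagrange.eval_interpolate_at_node (v := id) v (injOn_id _) hs
  have hp₁ : p₁.eval s = -(derivative p₀).eval s / (derivative w).eval s :=
    Lagrange.eval_interpolate_at_node (v := id) _ (injOn_id _) hs
  refine ⟨by simp [hw, hp₀], ?_⟩
  simp only [derivative_add, derivative_mul, eval_add, eval_mul, hw, hp₁]
  field_simp
  ring

-- Add the square of the nodal polynomial to the square of an interpolant of the square roots.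
theorem exists_pos_eval_eq_and_derivative_eval_eq_zero (D : Finset ℝ) {v : ℝ → ℝ}
    (hv : ∀ s ∈ D, 0 < v s) : ∃ m : ℝ[X], (∀ t, 0 < m.eval t) ∧
      ∀ s ∈ D, m.eval s = v s ∧ (derivative m).eval s = 0 := by
  obtain ⟨p, hp⟩ := exists_eval_eq_and_derivative_eval_eq_zero D fun s => √(v s)
  let w := Lagrange.nodal D (id : ℝ → ℝ)
  have hw : ∀ s ∈ D, w.eval s = 0 := fun s hs => Lagrange.eval_nodal_at_node (v := id) hs
  refine ⟨p ^ 2 + w ^ 2, fun t => ?_, fun s hs => ⟨?_, ?_⟩⟩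
  · rw [eval_add, eval_pow, eval_pow]
    by_cases ht : t ∈ D
    · have : 0 < p.eval t := by
        rw [(hp t ht).1]
        exact Real.sqrt_pos.2 (hv t ht)
      positivity
    · have : w.eval t ≠ 0 := Lagrange.eval_nodal_not_at_node (by rintro _ hj rfl; exact ht hj)
      positivity
  · simp [hw s hs, (hp s hs).1, Real.sq_sqrt (hv s hs).le]
  · simp [derivative_pow, hw s hs, (hp s hs).2]

theorem exists_X_sub_C_mul_sq_eval_eq (D : Finset ℝ) (v : ℝ → ℝ) :
    ∃ (m : ℝ[X]) (a b : ℝ), (∀ t, 0 < m.eval t) ∧ (∀ s ∈ D, a < s) ∧ ∀ s ∈ D,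
      ((X - C a) * m ^ 2).eval s = v s + b ∧ (derivative ((X - C a) * m ^ 2)).eval s ≠ 0 := by
  obtain ⟨a, ha⟩ : ∃ a, ∀ s ∈ D, a < s := by
    obtain ⟨a, ha⟩ := D.finite_toSet.bddBelow
    exact ⟨a - 1, fun s hs => (sub_one_lt a).trans_le (ha hs)⟩
  obtain ⟨b, hb⟩ : ∃ b, ∀ s ∈ D, 0 < v s + b := by
    obtain ⟨b, hb⟩ := (D.finite_toSet.image v).bddBelow
    exact ⟨1 - b, fun s hs => by linarith [hb (mem_image_of_mem v hs)]⟩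
  have hquot : ∀ s ∈ D, 0 < (v s + b) / (s - a) := fun s hs =>
    div_pos (hb s hs) (sub_pos.2 (ha s hs))
  obtain ⟨m, hm, hmD⟩ := exists_pos_eval_eq_and_derivative_eval_eq_zero D
    fun s hs => Real.sqrt_pos.2 (hquot s hs)
  refine ⟨m, a, b, hm, ha, fun s hs => ⟨?_, ?_⟩⟩
  · have := (sub_pos.2 (ha s hs)).ne'
    simp only [eval_mul, eval_sub, eval_X, eval_C, eval_pow, (hmD s hs).1,
      Real.sq_sqrt (hquot s hs).le]
    field_simp
  · simp [derivative_pow, (hmD s hs).2, (hm s).ne']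

theorem eventually_eval_nonneg {p : ℝ[X]} (hp : 0 ≤ p.leadingCoeff) :
    ∀ᶠ t in atTop, 0 ≤ p.eval t := by
  by_cases hdeg : 0 < p.degree
  · exact (p.tendsto_atTop_of_leadingCoeff_nonneg hdeg hp).eventually_ge_atTop 0
  · rw [eq_C_of_degree_le_zero (not_lt.1 hdeg), leadingCoeff_C] at hp
    rw [eq_C_of_degree_le_zero (not_lt.1 hdeg)]
    exact .of_forall fun t => by rwa [eval_C]

theorem leadingCoeff_nonneg_of_eval_pos {p : ℝ[X]} (hp : ∀ t, 0 < p.eval t) :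
    0 ≤ p.leadingCoeff := by
  by_contra! h
  obtain ⟨t, ht⟩ := (eventually_eval_nonneg (p := -p) (by rw [leadingCoeff_neg]; linarith)).exists
  rw [eval_neg] at ht
  linarith [hp t]

theorem exists_monotoneOn_Ici_eval {p : ℝ[X]} (hp : ∀ t, 0 < p.eval t) :
    ∃ b, 0 ≤ b ∧ MonotoneOn (fun t => p.eval t) (Ici b) := by
  have hlead : 0 ≤ (derivative p).leadingCoeff := by
    rw [leadingCoeff_derivative]
    exact mul_nonneg (leadingCoeff_nonneg_of_eval_pos hp) (Nat.cast_nonneg _)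
  obtain ⟨b, hb⟩ := eventually_atTop.1 (eventually_eval_nonneg hlead)
  refine ⟨max b 0, le_max_right _ _, monotoneOn_of_deriv_nonneg (convex_Ici _)
    p.continuous.continuousOn p.differentiable.differentiableOn fun t ht => ?_⟩
  rw [interior_Ici] at ht
  rw [Polynomial.deriv]
  exact hb t ((le_max_left _ _).trans (mem_Ioi.1 ht).le)

theorem tendsto_mul_sq_atTop {u m : ℝ → ℝ} {b : ℝ} (hu : Tendsto u atTop atTop) (hb : 0 < m b)
    (hm : MonotoneOn m (Ici b)) : Tendsto (fun t => u t * m t ^ 2) atTop atTop := by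
  refine tendsto_atTop_mono' _ ?_ (hu.atTop_mul_const (pow_pos hb 2))
  filter_upwards [hu.eventually_ge_atTop 0, eventually_ge_atTop b] with t hut ht
  exact mul_le_mul_of_nonneg_left (pow_le_pow_left₀ hb.le (hm self_mem_Ici ht ht) 2) hut

end Interpolation

/-! ### Knotted arcs of polynomial knots -/

theorem polyCurve_eq_iff {f g h : ℝ[X]} {s t : ℝ} : polyCurve f g h s = polyCurve f g h t ↔
    f.eval s = f.eval t ∧ g.eval s = g.eval t ∧ h.eval s = h.eval t := by
  simp [polyCurve]

theorem polyCurve_eq_zero_iff {f g h : ℝ[X]} {t : ℝ} : polyCurve f g h t = 0 ↔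
    f.eval t = 0 ∧ g.eval t = 0 ∧ h.eval t = 0 := by
  simp [polyCurve]

theorem ambientIsotopic_polyCurve_add_fst (f g h : ℝ[X]) (c : ℝ) :
    AmbientIsotopic (range (polyCurve f g h)) (range (polyCurve (f + C c * h) g h)) := by
  convert AmbientIsotopic.image_add_shear
    (e := fun x : EuclideanSpace ℝ (Fin 3) => !₂[c * x 2, 0, 0]) (by fun_prop) (by simp) _ using 1
  rw [← range_comp]
  congr 1
  funext t
  ext i
  fin_cases i <;> simp [polyCurve]

theorem ambientIsotopic_polyCurve_add_snd (f g h : ℝ[X]) (b c : ℝ) :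
    AmbientIsotopic (range (polyCurve f g h))
      (range (polyCurve f (g + C b * f + C c * h) h)) := by
  convert AmbientIsotopic.image_add_shear
    (e := fun x : EuclideanSpace ℝ (Fin 3) => !₂[0, b * x 0 + c * x 2, 0])
    (by fun_prop) (by simp) _ using 1
  rw [← range_comp]
  congr 1
  funext t
  ext i
  fin_cases i <;> simp [polyCurve, add_assoc]

namespace IsPolynomialKnot

variable {f g h : ℝ[X]}

theorem add_fst (hK : IsPolynomialKnot f g h) (c : ℝ) : IsPolynomialKnot (f + C c * h) g h where
  injective s t hst := by
    obtain ⟨hf, hg, hh⟩ := polyCurve_eq_iff.1 hst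
    exact hK.injective (polyCurve_eq_iff.2 ⟨by simpa [hh] using hf, hg, hh⟩)
  immersion t ht := by
    obtain ⟨hf, hg, hh⟩ := polyCurve_eq_zero_iff.1 ht
    exact hK.immersion t (polyCurve_eq_zero_iff.2 ⟨by simpa [hh] using hf, hg, hh⟩)

theorem add_snd (hK : IsPolynomialKnot f g h) (b c : ℝ) :
    IsPolynomialKnot f (g + C b * f + C c * h) h where
  injective s t hst := by
    obtain ⟨hf, hg, hh⟩ := polyCurve_eq_iff.1 hst
    exact hK.injective (polyCurve_eq_iff.2 ⟨hf, by simpa [hf, hh] using hg, hh⟩)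
  immersion t ht := by
    obtain ⟨hf, hg, hh⟩ := polyCurve_eq_zero_iff.1 ht
    exact hK.immersion t (polyCurve_eq_zero_iff.2 ⟨hf, by simpa [hf, hh] using hg, hh⟩)

theorem exists_degree_snd_pos (hK : IsPolynomialKnot f g h) :
    ∃ g₁, IsPolynomialKnot f g₁ h ∧ 0 < g₁.degree ∧
      AmbientIsotopic (range (polyCurve f g h)) (range (polyCurve f g₁ h)) := by
  obtain ⟨b, c, hbc⟩ : ∃ b c : ℝ, 0 < (g + C b * f + C c * h).degree := by
    by_contra! hconst
    have hder (b c : ℝ) : derivative (g + C b * f + C c * h) = 0 := by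
      rw [eq_C_of_degree_le_zero (hconst b c), derivative_C]
    have hg : derivative g = 0 := by simpa using hder 0 0
    have hf : derivative f = 0 := by simpa [hg] using hder 1 0
    have hh : derivative h = 0 := by simpa [hg] using hder 0 1
    exact hK.immersion 0 (polyCurve_eq_zero_iff.2 (by simp [hf, hg, hh]))
  exact ⟨_, hK.add_snd b c, hbc, ambientIsotopic_polyCurve_add_snd f g h b c⟩

end IsPolynomialKnot

/-- The finite set `D` contains the parameters of all double points and of all singular points of
the plane curve `(f, g)`. It says where the heights of a space curve over `(f, g)` matter for its
being a knot and for its knot type. -/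
structure IsCrossingSet (f g : ℝ[X]) (D : Finset ℝ) : Prop where
  double : ∀ s t, s ≠ t → f.eval s = f.eval t → g.eval s = g.eval t → s ∈ D
  singular : ∀ t, (derivative f).eval t = 0 → (derivative g).eval t = 0 → t ∈ D

-- Since the curve is an embedding, the divided differences have no common zeros.
theorem IsPolynomialKnot.exists_isCrossingSet {f g h : ℝ[X]} (hK : IsPolynomialKnot f g h)
    (hg : 0 < g.degree) : ∃ (c : ℝ) (D : Finset ℝ), IsCrossingSet (f + C c * h) g D := by
  have hno (s t : ℝ) (hgst : (dividedDiff g).evalEval s t = 0)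
      (hfst : (dividedDiff f).evalEval s t = 0) : (dividedDiff h).evalEval s t ≠ 0 := by
    intro hhst
    rcases eq_or_ne s t with rfl | hst
    · rw [evalEval_dividedDiff_self] at hfst hgst hhst
      exact hK.immersion s (polyCurve_eq_zero_iff.2 ⟨hfst, hgst, hhst⟩)
    · rw [evalEval_dividedDiff_eq_zero_iff hst] at hfst hgst hhst
      exact hst (hK.injective (polyCurve_eq_iff.2 ⟨hfst, hgst, hhst⟩))
  obtain ⟨c, hc⟩ :=
    (finite_infinite_commonAbscissas (dividedDiff_ne_zero hg) hno).infinite_compl.nonempty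
  rw [mem_compl_iff, mem_ofPred_eq, not_infinite, ← dividedDiff_add_C_mul] at hc
  refine ⟨c, hc.toFinset, fun s t hst hf hg => ?_, fun s hf hg => ?_⟩ <;>
    rw [Set.Finite.mem_toFinset]
  · exact ⟨t, (evalEval_dividedDiff_eq_zero_iff hst).2 hf,
      (evalEval_dividedDiff_eq_zero_iff hst).2 hg⟩
  · exact ⟨s, (evalEval_dividedDiff_self _ _).trans hf, (evalEval_dividedDiff_self _ _).trans hg⟩

theorem isClosedMap_prodMk_eval {Y : Type*} [TopologicalSpace Y] [T2Space Y] {f : ℝ → Y}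
    (hf : Continuous f) {g : ℝ[X]} (hg : 0 < g.degree) : IsClosedMap fun t => (f t, g.eval t) := by
  have hproper : IsProperMap (Prod.snd ∘ fun t => (f t, g.eval t)) := g.isProperMap_eval hg
  exact (isProperMap_of_comp_of_t2 (by fun_prop) continuous_snd hproper).isClosedMap

namespace IsCrossingSet

variable {f g : ℝ[X]} {D : Finset ℝ}

theorem isPolynomialKnot (hD : IsCrossingSet f g D) {h h' : ℝ[X]} (hK : IsPolynomialKnot f g h)
    {b : ℝ} (hDh : ∀ t ∈ D, h'.eval t = h.eval t + b)
    (hder : ∀ t ∈ D, (derivative h').eval t ≠ 0) : IsPolynomialKnot f g h' where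
  injective s t hst := by
    obtain ⟨hf, hg, hh⟩ := polyCurve_eq_iff.1 hst
    by_contra hne
    rw [hDh s (hD.double s t hne hf hg), hDh t (hD.double t s (Ne.symm hne) hf.symm hg.symm),
      add_left_inj] at hh
    exact hne (hK.injective (polyCurve_eq_iff.2 ⟨hf, hg, hh⟩))
  immersion t ht := by
    obtain ⟨hf, hg, hh⟩ := polyCurve_eq_zero_iff.1 ht
    exact hder t (hD.singular t hf hg) hh

theorem ambientIsotopic_range (hD : IsCrossingSet f g D) (hg : 0 < g.degree) {h h' : ℝ → ℝ}
    (hh : Continuous h) (hh' : Continuous h') {b : ℝ} (hDh : ∀ t ∈ D, h' t = h t + b) :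
    AmbientIsotopic (range fun t => (!₂[f.eval t, g.eval t, h t] : EuclideanSpace ℝ (Fin 3)))
      (range fun t => !₂[f.eval t, g.eval t, h' t]) := by
  let e : (ℝ × ℝ) × ℝ ≃ₜ EuclideanSpace ℝ (Fin 3) :=
    { toFun := fun p => !₂[p.1.1, p.1.2, p.2]
      invFun := fun x => ((x 0, x 1), x 2)
      left_inv := fun p => by simp
      right_inv := fun x => by ext i; fin_cases i <;> simp
      continuous_toFun := by fun_prop
      continuous_invFun := by fun_prop }
  have hprod := AmbientIsotopic.range_prodMk (π := fun t => (f.eval t, g.eval t)) (by fun_prop)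
    (isClosedMap_prodMk_eval f.continuous hg) hh hh' fun s t hst => by
      rw [Prod.mk.injEq] at hst
      rcases eq_or_ne s t with rfl | hne
      · rfl
      · rw [hDh s (hD.double s t hne hst.1 hst.2),
          hDh t (hD.double t s hne.symm hst.1.symm hst.2.symm)]
        ring
  simpa only [← range_comp] using! hprod.image_homeomorph e

end IsCrossingSet

section HalfSpaceArc

variable {f g h m : ℝ[X]} {a : ℝ}

-- The part `t ≤ a` is a graph over the lower half of the third axis.
theorem ambientIsotopic_straighten (ha : h.eval a = 0) (hpos : ∀ t, a < t → 0 < h.eval t) :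
    AmbientIsotopic
      (range fun t => (!₂[f.eval t, g.eval t, if t ≤ a then t - a else h.eval t] :
        EuclideanSpace ℝ (Fin 3)))
      (polyArc f g h a ∪ downwardRay (polyCurve f g h a)) := by
  have hnonneg (t : ℝ) (ht : a ≤ t) : 0 ≤ h.eval t := by
    rcases ht.eq_or_lt with rfl | ht
    exacts [ha.ge, (hpos t ht).le]
  have hupper (t : ℝ) (ht : a ≤ t) : (if t ≤ a then t - a else h.eval t) = h.eval t := by
    rcases ht.eq_or_lt with rfl | ht
    · simp [ha]
    · rw [if_neg ht.not_ge]
  convert AmbientIsotopic.image_add_shear (e := fun x : EuclideanSpace ℝ (Fin 3) =>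
      !₂[f.eval a - f.eval (a + min (x 2) 0), g.eval a - g.eval (a + min (x 2) 0), 0])
    (by fun_prop) (by simp) _ using 1
  rw [← range_comp]
  refine subset_antisymm (union_subset ?_ ?_) ?_
  · rintro _ ⟨t, ht, rfl⟩
    refine ⟨t, ?_⟩
    ext i
    fin_cases i <;> simp [polyCurve, hupper t ht, hnonneg t ht]
  · rintro x ⟨h0, h1, h2⟩
    simp only [polyCurve, PiLp.toLp_apply, Matrix.cons_val, ha] at h0 h1 h2
    refine ⟨a + x 2, ?_⟩
    ext i
    fin_cases i <;> simp [h0, h1, h2]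
  · rintro _ ⟨t, rfl⟩
    rcases le_total a t with ht | ht
    · refine Or.inl ⟨t, ht, ?_⟩
      ext i
      fin_cases i <;> simp [polyCurve, hupper t ht, hnonneg t ht]
    · right
      simp [downwardRay, ht, polyCurve, ha, sub_nonpos.2 ht]

theorem isHalfSpaceArc_X_sub_C_mul_sq (hm : ∀ t, 0 < m.eval t)
    (hknot : IsPolynomialKnot f g ((X - C a) * m ^ 2)) :
    IsHalfSpaceArc f g ((X - C a) * m ^ 2) a where
  knot := hknot
  endpoint := by simp
  positive t ht := by simpa using mul_pos (sub_pos.2 ht) (pow_pos (hm t) 2)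
  transverse := by simp [derivative_pow, (hm a).ne']
  infinite := by
    obtain ⟨b, -, hb⟩ := exists_monotoneOn_Ici_eval hm
    simpa [sub_eq_add_neg] using
      tendsto_mul_sq_atTop (tendsto_atTop_add_const_right _ (-a) tendsto_id) (hm b) hb

-- Over a generic plane projection the knot type only depends on the heights of the crossings.
-- These are prescribed on a new height function that has a single zero, to the left of them.
theorem IsPolynomialKnot.exists_isKnottedArcOf (hK : IsPolynomialKnot f g h) :
    ∃ (f₁ g₁ m : ℝ[X]) (a : ℝ), (∀ t, 0 < m.eval t) ∧
      IsKnottedArcOf f₁ g₁ ((X - C a) * m ^ 2) a (range (polyCurve f g h)) := by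
  obtain ⟨g₁, hK₁, hg₁, hiso₁⟩ := hK.exists_degree_snd_pos
  obtain ⟨c, D, hD⟩ := hK₁.exists_isCrossingSet hg₁
  obtain ⟨m, a, b, hm, haD, hDm⟩ := exists_X_sub_C_mul_sq_eval_eq D fun t => h.eval t
  have hiso := hiso₁.trans (ambientIsotopic_polyCurve_add_fst f g₁ h c)
  have harc := isHalfSpaceArc_X_sub_C_mul_sq hm
    (hD.isPolynomialKnot (hK₁.add_fst c) (fun t ht => (hDm t ht).1) fun t ht => (hDm t ht).2)
  refine ⟨f + C c * h, g₁, m, a, hm, harc, ?_, ?_⟩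
  · exact (hiso.trans (hD.ambientIsotopic_range hg₁ h.continuous
      ((X - C a) * m ^ 2).continuous fun t ht => (hDm t ht).1)).symm
  · refine (hiso.trans ((hD.ambientIsotopic_range (b := b) hg₁ h.continuous ?_ fun t ht => ?_).trans
      (ambientIsotopic_straighten harc.endpoint harc.positive))).symm
    · refine Continuous.if_le (by fun_prop) (by fun_prop) continuous_id continuous_const ?_
      rintro t rfl
      rw [harc.endpoint, sub_self]
    · exact (if_neg (haD t ht).not_ge).trans (hDm t ht).1

end HalfSpaceArc

/-! ### Chebyshev approximation -/

section InterpolationError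

variable {F u : ℝ → ℝ} {α β : ℝ} {n : ℕ} {Z : Finset ℝ}

theorem exists_finset_deriv_eq_zero (hF : ContinuousOn F (Icc α β)) (hZ : Z.card = n + 1)
    (hsub : ↑Z ⊆ Icc α β) (hzero : ∀ z ∈ Z, F z = 0) :
    ∃ Z' : Finset ℝ, Z'.card = n ∧ ↑Z' ⊆ Icc α β ∧ ∀ z ∈ Z', deriv F z = 0 := by
  let x := Z.orderEmbOfFin hZ
  have hx (i) : x i ∈ Z := Z.orderEmbOfFin_mem hZ i
  have hrolle (i : Fin n) : ∃ y ∈ Ioo (x i.castSucc) (x i.succ), deriv F y = 0 :=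
    exists_deriv_eq_zero (x.strictMono i.castSucc_lt_succ)
      (hF.mono (Icc_subset_Icc (hsub (hx _)).1 (hsub (hx _)).2))
      (by rw [hzero _ (hx _), hzero _ (hx _)])
  choose y hy hy0 using hrolle
  have hmono : StrictMono y := fun i j hij =>
    calc y i < x i.succ := (hy i).2
      _ ≤ x j.castSucc := x.monotone (Fin.succ_le_castSucc_iff.2 hij)
      _ < y j := (hy j).1
  refine ⟨Finset.univ.map ⟨y, hmono.injective⟩, by simp, ?_, by simpa using hy0⟩
  rw [Finset.coe_map, image_subset_iff]
  exact fun i _ => ⟨(hsub (hx _)).1.trans (hy i).1.le, (hy i).2.le.trans (hsub (hx _)).2⟩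

theorem exists_iteratedDeriv_eq_zero (hF : ContDiff ℝ n F) (hZ : Z.card = n + 1)
    (hsub : ↑Z ⊆ Icc α β) (hzero : ∀ z ∈ Z, F z = 0) : ∃ ξ ∈ Icc α β, iteratedDeriv n F ξ = 0 := by
  induction n generalizing F Z with
  | zero =>
    obtain ⟨z, hz⟩ := Finset.card_pos.1 (by lia : 0 < Z.card)
    exact ⟨z, hsub hz, by simpa using hzero z hz⟩
  | succ n ih =>
    rw [iteratedDeriv_succ']
    obtain ⟨Z', hZ', hsub', hzero'⟩ :=
      exists_finset_deriv_eq_zero hF.continuous.continuousOn hZ hsub hzero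
    exact ih (contDiff_succ_iff_deriv.1 (by exact_mod_cast hF)).2.2 hZ' hsub' hzero'

theorem iteratedDeriv_eval (p : ℝ[X]) (n : ℕ) :
    iteratedDeriv n (fun x => p.eval x) = fun x => (derivative^[n] p).eval x := by
  induction n with
  | zero => simp
  | succ n ih =>
    rw [iteratedDeriv_succ, ih, Function.iterate_succ_apply']
    exact funext fun x => Polynomial.deriv _

-- Apply the iterated theorem of Rolle to the error after interpolation in the further point `s`.
theorem exists_interpolation_error_eq (hu : ContDiff ℝ n u) {p : ℝ[X]} (hp : p.degree < n)
    (hZ : Z.card = n) (hsub : ↑Z ⊆ Icc α β) (hint : ∀ z ∈ Z, p.eval z = u z) {s : ℝ}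
    (hs : s ∈ Icc α β) : ∃ ξ ∈ Icc α β,
      u s - p.eval s = iteratedDeriv n u ξ / n.factorial * ∏ z ∈ Z, (s - z) := by
  by_cases hsZ : s ∈ Z
  · exact ⟨s, hs, by rw [hint s hsZ, sub_self, Finset.prod_eq_zero hsZ (sub_self s), mul_zero]⟩
  let w := Lagrange.nodal Z (id : ℝ → ℝ)
  have hws : w.eval s ≠ 0 := Lagrange.eval_nodal_not_at_node (by rintro _ hz rfl; exact hsZ hz)
  have hwZ (z) (hz : z ∈ Z) : w.eval z = 0 := Lagrange.eval_nodal_at_node (v := id) hz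
  let c := (u s - p.eval s) / w.eval s
  have herror : u s - p.eval s = c * w.eval s := (div_mul_cancel₀ _ hws).symm
  let q := p + C c * w
  have hder : derivative^[n] q = C (c * n.factorial) := by
    rw [iterate_map_add, iterate_derivative_eq_zero_of_degree_lt hp, zero_add,
      iterate_derivative_C_mul, show w = ∏ z ∈ Z, (X - C z) from Lagrange.nodal_eq _ _,
      iterate_derivative_prod_X_sub_C hZ.ge, hZ]
    simp
  have hq : ContDiff ℝ n fun x => q.eval x := by
    simp only [← coe_aeval_eq_eval]
    exact q.contDiff_aeval n
  obtain ⟨ξ, hξ, hξ0⟩ := exists_iteratedDeriv_eq_zero (F := u - fun x => q.eval x)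
    (Z := insert s Z) (hu.sub hq) (by rw [Finset.card_insert_of_notMem hsZ, hZ])
    (by simpa using insert_subset hs hsub) (by
      rw [Finset.forall_mem_insert]
      exact ⟨by simp [q, ← herror], fun z hz => by simp [q, hwZ z hz, hint z hz]⟩)
  rw [iteratedDeriv_sub hu.contDiffAt hq.contDiffAt, iteratedDeriv_eval, hder,
    sub_eq_zero] at hξ0
  simp only [eval_C] at hξ0
  refine ⟨ξ, hξ, ?_⟩
  rw [herror, hξ0, Lagrange.eval_nodal, mul_div_cancel_right₀ _ (by positivity)]
  rfl

theorem abs_sub_eval_le_of_interpolates {M : ℝ} (hu : ContDiff ℝ n u)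
    (hM : ∀ x ∈ Icc α β, |iteratedDeriv n u x| ≤ M) {p : ℝ[X]} (hp : p.degree < n)
    (hZ : Z.card = n) (hsub : ↑Z ⊆ Icc α β) (hint : ∀ z ∈ Z, p.eval z = u z) {s : ℝ}
    (hs : s ∈ Icc α β) : |u s - p.eval s| ≤ M * ((β - α) ^ n / n.factorial) := by
  obtain ⟨ξ, hξ, hξs⟩ := exists_interpolation_error_eq hu hp hZ hsub hint hs
  have hprod : |∏ z ∈ Z, (s - z)| ≤ (β - α) ^ n := by
    rw [Finset.abs_prod, ← hZ, ← Finset.prod_const]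
    refine Finset.prod_le_prod (fun _ _ => abs_nonneg _) fun z hz => abs_sub_le_iff.2 ⟨?_, ?_⟩
    exacts [sub_le_sub hs.2 (hsub hz).1, sub_le_sub (hsub hz).2 hs.1]
  calc |u s - p.eval s|
      = |iteratedDeriv n u ξ| / n.factorial * |∏ z ∈ Z, (s - z)| := by
        rw [hξs, abs_mul, abs_div, Nat.abs_cast]
    _ ≤ M / n.factorial * (β - α) ^ n := by
        have := (abs_nonneg _).trans (hM ξ hξ)
        gcongr
        exact hM ξ hξ
    _ = M * ((β - α) ^ n / n.factorial) := by ring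

end InterpolationError

section Chebyshev

variable {u : ℝ → ℝ} {α β : ℝ} {n : ℕ}

theorem chebyshevPoint_mem_Icc (h : α ≤ β) (n j : ℕ) : chebyshevPoint α β n j ∈ Icc α β := by
  have hnode := Chebyshev.node_mem_Icc (n := n) (i := j)
  constructor <;> unfold chebyshevPoint <;> nlinarith [hnode.1, hnode.2]

theorem chebyshevPoint_injOn (h : α < β) (n : ℕ) :
    InjOn (chebyshevPoint α β n) (Finset.range (n + 1)) := by
  intro i hi j hj hij
  have hlen : (β - α) / 2 ≠ 0 := by linarith
  refine (Chebyshev.strictAntiOn_node n).injOn hi hj ?_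
  exact mul_left_cancel₀ hlen (sub_right_injective hij)

theorem eval_chebyshevApprox (u : ℝ → ℝ) (h : α < β) {j : ℕ} (hj : j < n + 1) :
    (chebyshevApprox u α β n).eval (chebyshevPoint α β n j) = u (chebyshevPoint α β n j) :=
  Lagrange.eval_interpolate_at_node _ (chebyshevPoint_injOn h n) (Finset.mem_range.2 hj)

theorem eval_chebyshevApprox_left (u : ℝ → ℝ) (h : α < β) (n : ℕ) :
    (chebyshevApprox u α β n).eval α = u α := by
  have hpoint : chebyshevPoint α β n 0 = α := by
    rw [chebyshevPoint, Chebyshev.node_eq_one]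
    ring
  simpa only [hpoint] using eval_chebyshevApprox u h n.succ_pos

theorem eval_chebyshevApprox_right (u : ℝ → ℝ) (h : α < β) (hn : n ≠ 0) :
    (chebyshevApprox u α β n).eval β = u β := by
  have hpoint : chebyshevPoint α β n n = β := by
    rw [chebyshevPoint, Chebyshev.node_eq_neg_one hn]
    ring
  simpa only [hpoint] using eval_chebyshevApprox u h n.lt_succ_self

theorem degree_derivative_chebyshevApprox_lt (u : ℝ → ℝ) (h : α < β) :
    (derivative (chebyshevApprox u α β n)).degree < n := by
  have hdeg : (chebyshevApprox u α β n).degree < (n + 1 : ℕ) := by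
    simpa using! Lagrange.degree_interpolate_lt (fun j => u (chebyshevPoint α β n j))
      (chebyshevPoint_injOn h n)
  rw [degree_lt_iff_coeff_zero] at hdeg ⊢
  intro m hm
  rw [coeff_derivative, hdeg (m + 1) (by lia), zero_mul]

-- By Rolle's theorem the derivative of the approximation interpolates the derivative in `n` points.
theorem abs_deriv_sub_derivative_chebyshevApprox_le {M : ℝ} (hu : ContDiff ℝ (n + 1) u)
    (hM : ∀ x ∈ Icc α β, |iteratedDeriv (n + 1) u x| ≤ M) (h : α < β) {s : ℝ}
    (hs : s ∈ Icc α β) :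
    |deriv u s - (derivative (chebyshevApprox u α β n)).eval s| ≤
      M * ((β - α) ^ n / n.factorial) := by
  let p := chebyshevApprox u α β n
  have hinj := chebyshevPoint_injOn h n
  obtain ⟨hdiff, -, hu'⟩ := contDiff_succ_iff_deriv.1 hu
  obtain ⟨Z, hZ, hsub, hzero⟩ := exists_finset_deriv_eq_zero (F := fun x => u x - p.eval x)
    (Z := (Finset.range (n + 1)).image (chebyshevPoint α β n)) (α := α) (β := β)
    (hu.continuous.sub p.continuous).continuousOn
    (by rw [Finset.card_image_of_injOn hinj, Finset.card_range])
    (by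
      rw [Finset.coe_image, image_subset_iff]
      exact fun j _ => chebyshevPoint_mem_Icc h.le n j)
    (by
      rw [Finset.forall_mem_image]
      exact fun j hj => sub_eq_zero.2 (eval_chebyshevApprox u h (Finset.mem_range.1 hj)).symm)
  refine abs_sub_eval_le_of_interpolates hu' (by simpa only [iteratedDeriv_succ'] using hM)
    (degree_derivative_chebyshevApprox_lt u h) hZ hsub (fun z hz => ?_) hs
  have hz := hzero z hz
  rw [deriv_fun_sub (hdiff z) p.differentiableAt, Polynomial.deriv, sub_eq_zero] at hz
  exact hz.symm

/-- The function `v` agrees with `u` at the end points of `[α, β]`, and the error `v - u` has the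
Lipschitz constant `δ` there. Such approximations of the sine and the cosine give a closed curve
that is isotopic to the circle. -/
structure IsLipschitzApprox (δ : NNReal) (u v : ℝ → ℝ) (α β : ℝ) : Prop where
  left : v α = u α
  right : v β = u β
  lipschitz : LipschitzOnWith δ (v - u) (Icc α β)

theorem IsLipschitzApprox.abs_sub_le {δ : NNReal} {v : ℝ → ℝ} (h : IsLipschitzApprox δ u v α β)
    {s : ℝ} (hs : s ∈ Icc α β) : |v s - u s| ≤ δ * (β - α) := by
  have := h.lipschitz.dist_le_mul s hs α (left_mem_Icc.2 (hs.1.trans hs.2))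
  rw [dist_eq_norm, dist_eq_norm, Pi.sub_apply, Pi.sub_apply, h.left, sub_self, sub_zero,
    Real.norm_of_nonneg (sub_nonneg.2 hs.1)] at this
  exact this.trans (by gcongr; exact hs.2)

theorem eventually_isLipschitzApprox_chebyshevApprox {M : ℝ} (hu : ContDiff ℝ ∞ u)
    (hM : ∀ n, ∀ x ∈ Icc α β, |iteratedDeriv n u x| ≤ M) (h : α < β) {δ : NNReal} (hδ : 0 < δ) :
    ∀ᶠ n in atTop, IsLipschitzApprox δ u (fun s => (chebyshevApprox u α β n).eval s) α β := by
  have hlim := (FloorSemiring.tendsto_pow_div_factorial_atTop (β - α)).const_mul M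
  rw [mul_zero] at hlim
  filter_upwards [hlim.eventually_le_const (NNReal.coe_pos.2 hδ), eventually_ne_atTop 0]
    with n hn hn0
  refine ⟨eval_chebyshevApprox_left u h n, eval_chebyshevApprox_right u h hn0,
    (convex_Icc α β).lipschitzOnWith_of_nnnorm_hasDerivWithin_le (fun x _ =>
      (((chebyshevApprox u α β n).hasDerivAt x).sub
        (hu.differentiable (by simp) x).hasDerivAt).hasDerivWithinAt) fun x hx => ?_⟩
  rw [← NNReal.coe_le_coe, coe_nnnorm, norm_sub_rev]
  exact (abs_deriv_sub_derivative_chebyshevApprox_le (hu.of_le (by exact_mod_cast le_top))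
    (hM _) h hx).trans hn

end Chebyshev

/-! ### Spinning with approximations of sine and cosine -/

section RadialExtension

theorem dist_le_mul_min_of_lipschitzOnWith {X : Type*} [PseudoMetricSpace X] {ζ : ℝ → X}
    {K : NNReal} {α β : ℝ} (hζ : LipschitzOnWith K ζ (Icc α β)) (hloop : ζ α = ζ β) {s t : ℝ}
    (hs : s ∈ Icc α β) (ht : t ∈ Icc α β) :
    dist (ζ s) (ζ t) ≤ K * min |s - t| (β - α - |s - t|) := by
  wlog hts : t ≤ s generalizing s t
  · rw [dist_comm, abs_sub_comm]
    exact this ht hs (le_of_not_ge hts)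
  have hα := left_mem_Icc.2 (hs.1.trans hs.2)
  have hβ := right_mem_Icc.2 (hs.1.trans hs.2)
  rw [mul_min_of_nonneg _ _ K.coe_nonneg, le_min_iff, ← Real.dist_eq]
  refine ⟨hζ.dist_le_mul s hs t ht, ?_⟩
  calc dist (ζ s) (ζ t) ≤ dist (ζ s) (ζ β) + dist (ζ α) (ζ t) :=
        hloop ▸ dist_triangle (ζ s) (ζ β) (ζ t)
    _ ≤ K * dist s β + K * dist α t :=
        add_le_add (hζ.dist_le_mul s hs β hβ) (hζ.dist_le_mul α hα t ht)
    _ = K * (β - α - dist s t) := by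
        rw [Real.dist_eq, Real.dist_eq, Real.dist_eq, abs_of_nonpos (sub_nonpos.2 hs.2),
          abs_of_nonpos (sub_nonpos.2 ht.1), abs_of_nonneg (sub_nonneg.2 hts)]
        ring

theorem two_div_pi_mul_min_le_sin {x : ℝ} (hx : x ∈ Icc 0 Real.pi) :
    2 / Real.pi * min x (Real.pi - x) ≤ Real.sin x := by
  rcases le_total x (Real.pi / 2) with h | h
  · rw [min_eq_left (by linarith)]
    exact Real.mul_le_sin hx.1 h
  · rw [min_eq_right (by linarith), ← Real.sin_pi_sub]
    exact Real.mul_le_sin (sub_nonneg.2 hx.2) (by linarith)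

theorem two_div_pi_mul_min_le_norm_exp_sub_exp {s t : ℝ} (hst : |s - t| ≤ 2 * Real.pi) :
    2 / Real.pi * min |s - t| (2 * Real.pi - |s - t|) ≤
      ‖Complex.exp (s * Complex.I) - Complex.exp (t * Complex.I)‖ := by
  have hsin := two_div_pi_mul_min_le_sin (x := |s - t| / 2) ⟨by positivity, by linarith⟩
  calc 2 / Real.pi * min |s - t| (2 * Real.pi - |s - t|)
      = 2 * (2 / Real.pi * min (|s - t| / 2) (Real.pi - |s - t| / 2)) := by
        rw [mul_left_comm, mul_min_of_nonneg (a := 2) _ _ zero_le_two]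
        ring_nf
    _ ≤ 2 * |Real.sin ((s - t) / 2)| := by
        gcongr
        refine hsin.trans ?_
        rcases abs_choice (s - t) with h | h
        · rw [h]
          exact le_abs_self _
        · rw [h, neg_div, Real.sin_neg]
          exact neg_le_abs _
    _ = ‖Complex.exp (Complex.I * (s - t : ℝ)) - 1‖ := by
        rw [Complex.norm_exp_I_mul_ofReal_sub_one, norm_mul, Real.norm_ofNat, Real.norm_eq_abs]
    _ = ‖Complex.exp (t * Complex.I) * (Complex.exp (Complex.I * (s - t : ℝ)) - 1)‖ := by
        rw [norm_mul, Complex.norm_exp_ofReal_mul_I, one_mul]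
    _ = ‖Complex.exp (s * Complex.I) - Complex.exp (t * Complex.I)‖ := by
        rw [mul_sub, ← Complex.exp_add, mul_one]
        congr 3
        push_cast
        ring

theorem abs_sub_le_of_mem_Icc {s t β : ℝ} (hs : s ∈ Icc 0 β) (ht : t ∈ Icc 0 β) : |s - t| ≤ β :=
  abs_sub_le_iff.2 ⟨by linarith [hs.2, ht.1], by linarith [hs.1, ht.2]⟩

theorem norm_smul_sub_smul_le {V W : Type*} [NormedAddCommGroup V] [NormedSpace ℝ V]
    [NormedAddCommGroup W] [NormedSpace ℝ W] {p p' : V} {z z' : W} {r r' L M : ℝ}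
    (hp : ‖p‖ = 1) (hp' : ‖p'‖ = 1) (hr : 0 ≤ r) (hr' : 0 ≤ r') (hL : 0 ≤ L)
    (hz : ‖z - z'‖ ≤ L * ‖p - p'‖) (hz' : ‖z'‖ ≤ M) :
    ‖r • z - r' • z'‖ ≤ (2 * L + M) * ‖r • p - r' • p'‖ := by
  have hradius : |r - r'| ≤ ‖r • p - r' • p'‖ := by
    have := abs_norm_sub_norm_le (r • p) (r' • p')
    rwa [norm_smul, norm_smul, hp, hp', mul_one, mul_one, Real.norm_of_nonneg hr,
      Real.norm_of_nonneg hr'] at this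
  have hdirection : r * ‖p - p'‖ ≤ 2 * ‖r • p - r' • p'‖ := by
    calc r * ‖p - p'‖ = ‖r • p - r' • p' - (r - r') • p'‖ := by
          rw [← Real.norm_of_nonneg hr, ← norm_smul, Real.norm_of_nonneg hr]
          congr 1
          module
      _ ≤ ‖r • p - r' • p'‖ + |r - r'| := by
          refine (norm_sub_le _ _).trans_eq ?_
          rw [norm_smul (r - r'), hp', mul_one, Real.norm_eq_abs]
      _ ≤ 2 * ‖r • p - r' • p'‖ := by linarith
  calc ‖r • z - r' • z'‖ = ‖r • (z - z') + (r - r') • z'‖ := by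
        congr 1
        module
    _ ≤ r * ‖z - z'‖ + |r - r'| * ‖z'‖ := by
        refine (norm_add_le _ _).trans_eq ?_
        rw [norm_smul, norm_smul, Real.norm_of_nonneg hr, Real.norm_eq_abs]
    _ ≤ r * (L * ‖p - p'‖) + ‖r • p - r' • p'‖ * M := by gcongr
    _ = L * (r * ‖p - p'‖) + M * ‖r • p - r' • p'‖ := by ring
    _ ≤ L * (2 * ‖r • p - r' • p'‖) + M * ‖r • p - r' • p'‖ := by gcongr
    _ = (2 * L + M) * ‖r • p - r' • p'‖ := by ring

theorem exists_eq_norm_smul_exp (w : ℂ) :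
    ∃ θ ∈ Icc (0 : ℝ) (2 * Real.pi), w = ‖w‖ • Complex.exp (θ * Complex.I) := by
  have hw : w = ‖w‖ • Complex.exp (w.arg * Complex.I) := by
    rw [Complex.real_smul, w.norm_mul_exp_arg_mul_I]
  rcases le_or_gt 0 w.arg with h | h
  · exact ⟨w.arg, ⟨h, by linarith [w.arg_le_pi, Real.pi_pos]⟩, hw⟩
  · refine ⟨w.arg + 2 * Real.pi, ⟨by linarith [w.neg_pi_lt_arg, Real.pi_pos], by linarith⟩, ?_⟩
    push_cast
    rwa [add_mul, Complex.exp_add, Complex.exp_two_pi_mul_I, mul_one]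

theorem norm_smul_sub_smul_le_of_lipschitzOnWith {E : Type*} [NormedAddCommGroup E]
    [NormedSpace ℝ E] {ζ : ℝ → E} {K : NNReal}
    (hζ : LipschitzOnWith K ζ (Icc (0 : ℝ) (2 * Real.pi))) (h0 : ζ 0 = 0)
    (h2π : ζ (2 * Real.pi) = 0) {r r' s s' : ℝ} (hr : 0 ≤ r) (hr' : 0 ≤ r')
    (hs : s ∈ Icc (0 : ℝ) (2 * Real.pi)) (hs' : s' ∈ Icc (0 : ℝ) (2 * Real.pi)) :
    ‖r • ζ s - r' • ζ s'‖ ≤ 8 * K *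
      ‖r • Complex.exp (s * Complex.I) - r' • Complex.exp (s' * Complex.I)‖ := by
  have hpi := Real.pi_pos
  have hloop {s t : ℝ} := dist_le_mul_min_of_lipschitzOnWith (s := s) (t := t) hζ
    (h0.trans h2π.symm)
  rw [sub_zero] at hloop
  have hchord : ‖ζ s - ζ s'‖ ≤
      K * 2 * ‖Complex.exp (s * Complex.I) - Complex.exp (s' * Complex.I)‖ := by
    have hle := two_div_pi_mul_min_le_norm_exp_sub_exp (abs_sub_le_of_mem_Icc hs hs')
    rw [div_mul_eq_mul_div, div_le_iff₀ hpi] at hle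
    rw [← dist_eq_norm, mul_assoc]
    refine (hloop hs hs').trans (mul_le_mul_of_nonneg_left ?_ K.coe_nonneg)
    linarith [mul_le_mul_of_nonneg_left Real.pi_le_four
      (norm_nonneg (Complex.exp (s * Complex.I) - Complex.exp (s' * Complex.I)))]
  have hbound : ‖ζ s'‖ ≤ K * 4 := by
    have hle := hloop hs' (left_mem_Icc.2 (by positivity))
    rw [h0, dist_zero_right] at hle
    refine hle.trans (mul_le_mul_of_nonneg_left ?_ K.coe_nonneg)
    linarith [min_le_left |s' - 0| (2 * Real.pi - |s' - 0|),
      min_le_right |s' - 0| (2 * Real.pi - |s' - 0|), Real.pi_le_four]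
  exact (norm_smul_sub_smul_le (Complex.norm_exp_ofReal_mul_I s)
    (Complex.norm_exp_ofReal_mul_I s') hr hr' (by positivity) hchord hbound).trans_eq (by ring)

theorem exists_radial_extension {E : Type*} [NormedAddCommGroup E] [NormedSpace ℝ E] {ζ : ℝ → E}
    {K : NNReal} (hζ : LipschitzOnWith K ζ (Icc (0 : ℝ) (2 * Real.pi))) (h0 : ζ 0 = 0)
    (h2π : ζ (2 * Real.pi) = 0) : ∃ e : ℂ → E, LipschitzWith (8 * K) e ∧
      ∀ r : ℝ, 0 ≤ r → ∀ s ∈ Icc (0 : ℝ) (2 * Real.pi),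
        e (r • Complex.exp (s * Complex.I)) = r • ζ s := by
  choose θ hθ hw using exists_eq_norm_smul_exp
  have hle {r r' s s' : ℝ} := norm_smul_sub_smul_le_of_lipschitzOnWith
    (r := r) (r' := r') (s := s) (s' := s') hζ h0 h2π
  refine ⟨fun w => ‖w‖ • ζ (θ w), .of_dist_le_mul fun v w => ?_, fun r hr s hs => ?_⟩
  · have := hle (norm_nonneg v) (norm_nonneg w) (hθ v) (hθ w)
    rwa [← hw, ← hw, ← dist_eq_norm, ← dist_eq_norm] at this
  · set w := r • Complex.exp (s * Complex.I) with hrs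
    have := hle (norm_nonneg w) hr (hθ w) hs
    rwa [← hw, ← hrs, sub_self, norm_zero, mul_zero, norm_le_zero_iff, sub_eq_zero] at this

end RadialExtension

section Spin

/-- The point `p` of the upper half space, rotated in `ℝ⁴` about the plane `{(x, y, 0, 0)}`. As in
`spinParam`, the angle `s` is measured from the fourth axis towards the third one. -/
noncomputable def spinPoint (p : EuclideanSpace ℝ (Fin 3)) (s : ℝ) : EuclideanSpace ℝ (Fin 4) :=
  !₂[p 0, p 1, p 2 * Real.sin s, p 2 * Real.cos s]

theorem exists_eq_mul_sin_and_eq_mul_cos {c d r : ℝ} (hr : 0 ≤ r) (h : c ^ 2 + d ^ 2 = r ^ 2) :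
    ∃ s ∈ Icc 0 (2 * Real.pi), c = r * Real.sin s ∧ d = r * Real.cos s := by
  obtain ⟨s, hs, hw⟩ := exists_eq_norm_smul_exp ⟨d, c⟩
  have hnorm : ‖(⟨d, c⟩ : ℂ)‖ = r := by
    rw [Complex.norm_def, Complex.normSq_mk, ← Real.sqrt_sq hr, ← h]
    congr 1
    ring
  rw [hnorm] at hw
  refine ⟨s, hs, ?_, ?_⟩
  · simpa [Complex.exp_ofReal_mul_I_im] using congrArg Complex.im hw
  · simpa [Complex.exp_ofReal_mul_I_re] using congrArg Complex.re hw

theorem mem_spin_iff {k : Set (EuclideanSpace ℝ (Fin 3))} (hk : ∀ p ∈ k, 0 ≤ p 2)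
    {q : EuclideanSpace ℝ (Fin 4)} :
    q ∈ spin k ↔ ∃ p ∈ k, q 0 = p 0 ∧ q 1 = p 1 ∧ q 2 ^ 2 + q 3 ^ 2 = p 2 ^ 2 := by
  constructor
  · rintro ⟨p, hp, θ, -, rfl⟩
    refine ⟨p, hp, rfl, rfl, ?_⟩
    simp only [Matrix.cons_val]
    linear_combination p 2 ^ 2 * Real.sin_sq_add_cos_sq θ
  · rintro ⟨p, hp, h0, h1, h2⟩
    obtain ⟨s, hs, h3, h4⟩ := exists_eq_mul_sin_and_eq_mul_cos (hk p hp)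
      ((add_comm (q 3 ^ 2) _).trans h2)
    refine ⟨p, hp, s, hs, ?_⟩
    ext i
    fin_cases i
    exacts [h0, h1, h4, h3]

theorem spin_eq_image2 (k : Set (EuclideanSpace ℝ (Fin 3))) :
    spin k = image2 spinPoint k (Icc 0 (2 * Real.pi)) := by
  have hswap (θ : ℝ) :
      ∃ s ∈ Icc 0 (2 * Real.pi), Real.sin s = Real.cos θ ∧ Real.cos s = Real.sin θ := by
    obtain ⟨s, hs, hsin, hcos⟩ := exists_eq_mul_sin_and_eq_mul_cos zero_le_one
      ((Real.cos_sq_add_sin_sq θ).trans (one_pow 2).symm)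
    exact ⟨s, hs, by rw [hsin, one_mul], by rw [hcos, one_mul]⟩
  ext q
  constructor
  · rintro ⟨p, hp, θ, -, rfl⟩
    obtain ⟨s, hs, hsin, hcos⟩ := hswap θ
    exact ⟨p, hp, s, hs, by rw [spinPoint, hsin, hcos]⟩
  · rintro ⟨p, hp, s, -, rfl⟩
    obtain ⟨θ, hθ, hsin, hcos⟩ := hswap s
    exact ⟨p, hp, θ, hθ, by rw [spinPoint, hsin, hcos]⟩

theorem eq_or_endpoints_of_exp_eq_exp {s t : ℝ} (hs : s ∈ Icc 0 (2 * Real.pi))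
    (ht : t ∈ Icc 0 (2 * Real.pi))
    (h : Complex.exp (s * Complex.I) = Complex.exp (t * Complex.I)) :
    s = t ∨ (s = 0 ∧ t = 2 * Real.pi) ∨ (s = 2 * Real.pi ∧ t = 0) := by
  have hle := two_div_pi_mul_min_le_norm_exp_sub_exp (abs_sub_le_of_mem_Icc hs ht)
  rw [h, sub_self, norm_zero, mul_nonpos_iff_pos_imp_nonpos, min_le_iff, abs_nonpos_iff] at hle
  rcases hle.1 (by positivity) with h | h
  · exact .inl (sub_eq_zero.1 h)
  · rcases le_abs.1 (sub_nonpos.1 h) with h | h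
    · exact .inr (.inr ⟨by linarith [hs.2, ht.1], by linarith [hs.2, ht.1]⟩)
    · exact .inr (.inl ⟨by linarith [hs.1, ht.2], by linarith [hs.1, ht.2]⟩)

theorem spinPoint_eq_iff {p p' : EuclideanSpace ℝ (Fin 3)} (hp : 0 ≤ p 2) (hp' : 0 ≤ p' 2)
    {s s' : ℝ} (hs : s ∈ Icc 0 (2 * Real.pi)) (hs' : s' ∈ Icc 0 (2 * Real.pi)) :
    spinPoint p s = spinPoint p' s' ↔ p = p' ∧ (p 2 = 0 ∨ s = s' ∨
      (s = 0 ∧ s' = 2 * Real.pi) ∨ (s = 2 * Real.pi ∧ s' = 0)) := by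
  constructor
  · intro h
    have h0 : p 0 = p' 0 := congrArg (fun x => x 0) h
    have h1 : p 1 = p' 1 := congrArg (fun x => x 1) h
    have h2 : p 2 * Real.sin s = p' 2 * Real.sin s' := congrArg (fun x => x 2) h
    have h3 : p 2 * Real.cos s = p' 2 * Real.cos s' := congrArg (fun x => x 3) h
    have hheight : p 2 = p' 2 := by
      rw [← sq_eq_sq₀ hp hp']
      linear_combination (p 2 * Real.sin s + p' 2 * Real.sin s') * h2 +
        (p 2 * Real.cos s + p' 2 * Real.cos s') * h3 - p 2 ^ 2 * Real.sin_sq_add_cos_sq s +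
        p' 2 ^ 2 * Real.sin_sq_add_cos_sq s'
    refine ⟨by ext i; fin_cases i; exacts [h0, h1, hheight], or_iff_not_imp_left.2 fun hne => ?_⟩
    rw [← hheight] at h2 h3
    refine eq_or_endpoints_of_exp_eq_exp hs hs' (Complex.ext ?_ ?_)
    · simpa [Complex.exp_ofReal_mul_I_re] using mul_left_cancel₀ hne h3
    · simpa [Complex.exp_ofReal_mul_I_im] using mul_left_cancel₀ hne h2
  · rintro ⟨rfl, h | rfl | ⟨rfl, rfl⟩ | ⟨rfl, rfl⟩⟩ <;> simp [spinPoint, *]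

-- The displacement on the circles about the plane `{(x, y, 0, 0)}` is extended radially.
theorem exists_spinPoint_add_eq {S C : ℝ → ℝ} {δ : NNReal} (hδ : δ ≤ 1 / 32)
    (hS : IsLipschitzApprox δ Real.sin S 0 (2 * Real.pi))
    (hC : IsLipschitzApprox δ Real.cos C 0 (2 * Real.pi)) :
    ∃ e : EuclideanSpace ℝ (Fin 4) → EuclideanSpace ℝ (Fin 4), LipschitzWith (1 / 2) e ∧
      ∀ p : EuclideanSpace ℝ (Fin 3), 0 ≤ p 2 → ∀ s ∈ Icc 0 (2 * Real.pi),
        spinPoint p s + e (spinPoint p s) = !₂[p 0, p 1, p 2 * S s, p 2 * C s] := by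
  let ζ (s : ℝ) : EuclideanSpace ℝ (Fin 4) := !₂[0, 0, S s - Real.sin s, C s - Real.cos s]
  have hζ : LipschitzOnWith (2 * δ) ζ (Icc 0 (2 * Real.pi)) :=
    LipschitzOnWith.of_dist_le_mul fun s hs t ht => by
      have hS' := hS.lipschitz.dist_le_mul s hs t ht
      have hC' := hC.lipschitz.dist_le_mul s hs t ht
      rw [EuclideanSpace.dist_eq, Fin.sum_univ_four, Real.sqrt_le_left (by positivity)]
      calc _ = 0 ^ 2 + 0 ^ 2 + dist ((S - Real.sin) s) ((S - Real.sin) t) ^ 2 +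
            dist ((C - Real.cos) s) ((C - Real.cos) t) ^ 2 := by simp [ζ]
        _ ≤ 0 ^ 2 + 0 ^ 2 + (δ * dist s t) ^ 2 + (δ * dist s t) ^ 2 := by gcongr
        _ ≤ ((2 * δ : NNReal) * dist s t) ^ 2 := by
          push_cast
          linarith [sq_nonneg (δ * dist s t)]
  obtain ⟨e, he, hes⟩ := exists_radial_extension hζ
    (by ext i; fin_cases i <;> simp [ζ, hS.left, hC.left])
    (by ext i; fin_cases i <;> simp [ζ, hS.right, hC.right])
  have hproj : LipschitzWith 1 fun q : EuclideanSpace ℝ (Fin 4) => (⟨q 3, q 2⟩ : ℂ) :=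
    LipschitzWith.of_dist_le_mul fun q q' => by
      rw [NNReal.coe_one, one_mul, Complex.dist_eq_re_im, EuclideanSpace.dist_eq,
        Fin.sum_univ_four]
      simp only [Real.dist_eq, sq_abs]
      exact Real.sqrt_le_sqrt (by linarith [sq_nonneg (q 0 - q' 0), sq_nonneg (q 1 - q' 1)])
  refine ⟨fun q => e ⟨q 3, q 2⟩, (he.comp hproj).weaken ?_, fun p hp s hs => ?_⟩
  · calc 8 * (2 * δ) * 1 ≤ 8 * (2 * (1 / 32)) * 1 := by gcongr
      _ = 1 / 2 := by norm_num
  · have hpolar : (⟨p 2 * Real.cos s, p 2 * Real.sin s⟩ : ℂ) =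
        p 2 • Complex.exp (s * Complex.I) := by
      apply Complex.ext <;> simp [Complex.exp_ofReal_mul_I_re, Complex.exp_ofReal_mul_I_im]
    have hdisp : e ⟨p 2 * Real.cos s, p 2 * Real.sin s⟩ = p 2 • ζ s := by
      rw [hpolar, hes _ hp s hs]
    ext i
    fin_cases i <;> simp [spinPoint, hdisp, ζ] <;> ring

end Spin

namespace IsHalfSpaceArc

variable {f g h S C : ℝ[X]} {a : ℝ} {δ : NNReal}

theorem nonneg (hk : IsHalfSpaceArc f g h a) {t : ℝ} (ht : a ≤ t) : 0 ≤ h.eval t := by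
  rcases ht.eq_or_lt with rfl | ht
  exacts [hk.endpoint.ge, (hk.positive t ht).le]

theorem exists_spinParam_eq (hk : IsHalfSpaceArc f g h a) (hδ : δ ≤ 1 / 32)
    (hS : IsLipschitzApprox δ Real.sin (fun s => S.eval s) 0 (2 * Real.pi))
    (hC : IsLipschitzApprox δ Real.cos (fun s => C.eval s) 0 (2 * Real.pi)) :
    ∃ e : EuclideanSpace ℝ (Fin 4) → EuclideanSpace ℝ (Fin 4), LipschitzWith (1 / 2) e ∧
      ∀ t ∈ Ici a, ∀ s ∈ Icc 0 (2 * Real.pi), spinParam f g h S C (t, s) =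
        spinPoint (polyCurve f g h t) s + e (spinPoint (polyCurve f g h t) s) := by
  obtain ⟨e, he, hes⟩ := exists_spinPoint_add_eq hδ hS hC
  exact ⟨e, he, fun t ht s hs => (hes (polyCurve f g h t) (hk.nonneg ht) s hs).symm⟩

theorem spinParam_eq_iff (hk : IsHalfSpaceArc f g h a) (hδ : δ ≤ 1 / 32)
    (hS : IsLipschitzApprox δ Real.sin (fun s => S.eval s) 0 (2 * Real.pi))
    (hC : IsLipschitzApprox δ Real.cos (fun s => C.eval s) 0 (2 * Real.pi)) {t t' s s' : ℝ}
    (ht : t ∈ Ici a) (ht' : t' ∈ Ici a) (hs : s ∈ Icc 0 (2 * Real.pi))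
    (hs' : s' ∈ Icc 0 (2 * Real.pi)) :
    spinParam f g h S C (t, s) = spinParam f g h S C (t', s') ↔
      t = t' ∧ (t = a ∨ s = s' ∨ (s = 0 ∧ s' = 2 * Real.pi) ∨ (s = 2 * Real.pi ∧ s' = 0)) := by
  obtain ⟨e, he, hes⟩ := hk.exists_spinParam_eq hδ hS hC
  have hinj : Function.Injective fun x => x + e x :=
    (AntilipschitzWith.id.add_lipschitzWith he (by norm_num)).injective
  have hzero : h.eval t = 0 ↔ t = a := by
    refine ⟨fun h0 => ?_, fun hta => hta ▸ hk.endpoint⟩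
    by_contra hne
    exact (hk.positive t (lt_of_le_of_ne ht (Ne.symm hne))).ne' h0
  rw [hes t ht s hs, hes t' ht' s' hs', hinj.eq_iff,
    spinPoint_eq_iff (hk.nonneg ht) (hk.nonneg ht') hs hs', hk.knot.injective.eq_iff, ← hzero]
  rfl

theorem ambientIsotopic_image_spinParam (hk : IsHalfSpaceArc f g h a) (hδ : δ ≤ 1 / 32)
    (hS : IsLipschitzApprox δ Real.sin (fun s => S.eval s) 0 (2 * Real.pi))
    (hC : IsLipschitzApprox δ Real.cos (fun s => C.eval s) 0 (2 * Real.pi)) :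
    AmbientIsotopic (spinParam f g h S C '' (Ici a ×ˢ Icc 0 (2 * Real.pi)))
      (spin (polyArc f g h a)) := by
  obtain ⟨e, he, hes⟩ := hk.exists_spinParam_eq hδ hS hC
  have himage : spinParam f g h S C '' (Ici a ×ˢ Icc 0 (2 * Real.pi)) =
      (fun x => x + e x) '' spin (polyArc f g h a) := by
    rw [spin_eq_image2, polyArc, image2_image_left, image_image2, ← image_uncurry_prod]
    exact image_congr fun x hx => hes x.1 hx.1 x.2 hx.2
  rw [himage]
  exact (AmbientIsotopic.image_add_contraction (by norm_num) he _).symm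

theorem spinParam_chebyshevApprox (hk : IsHalfSpaceArc f g h a) {ε : ℝ} (hε : 0 < ε) :
    ∃ N : ℕ, ∀ n : ℕ, N ≤ n → ∀ S C : ℝ[X],
      S = chebyshevApprox Real.sin 0 (2 * Real.pi) n →
      C = chebyshevApprox Real.cos 0 (2 * Real.pi) n →
      (∀ s ∈ Icc (0 : ℝ) (2 * Real.pi),
        |S.eval s - Real.sin s| < ε ∧ |C.eval s - Real.cos s| < ε) ∧
      (∀ t ∈ Ici a, ∀ t' ∈ Ici a, ∀ s ∈ Icc (0 : ℝ) (2 * Real.pi),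
        ∀ s' ∈ Icc (0 : ℝ) (2 * Real.pi),
        (spinParam f g h S C (t, s) = spinParam f g h S C (t', s') ↔
          t = t' ∧ (t = a ∨ s = s' ∨ (s = 0 ∧ s' = 2 * Real.pi) ∨
            (s = 2 * Real.pi ∧ s' = 0)))) ∧
      AmbientIsotopic (spinParam f g h S C '' (Ici a ×ˢ Icc (0 : ℝ) (2 * Real.pi)))
        (spin (polyArc f g h a)) := by
  let δ : NNReal := min (ε / 8).toNNReal (1 / 32)
  have hδ0 : 0 < δ := lt_min (Real.toNNReal_pos.2 (by positivity)) (by norm_num)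
  have hδ : δ ≤ 1 / 32 := min_le_right _ _
  have hδε : δ * (2 * Real.pi - 0) < ε := by
    have : (δ : ℝ) ≤ ε / 8 := NNReal.coe_le_coe.2 (min_le_left _ _) |>.trans_eq
      (Real.coe_toNNReal _ (by positivity))
    nlinarith [Real.pi_lt_four]
  obtain ⟨N, hN⟩ := eventually_atTop.1
    ((eventually_isLipschitzApprox_chebyshevApprox Real.contDiff_sin
      (fun n x _ => Real.abs_iteratedDeriv_sin_le_one n x) Real.two_pi_pos hδ0).and
    (eventually_isLipschitzApprox_chebyshevApprox Real.contDiff_cos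
      (fun n x _ => Real.abs_iteratedDeriv_cos_le_one n x) Real.two_pi_pos hδ0))
  refine ⟨N, ?_⟩
  rintro n hn _ _ rfl rfl
  obtain ⟨hS, hC⟩ := hN n hn
  exact ⟨fun s hs => ⟨(hS.abs_sub_le hs).trans_lt hδε, (hC.abs_sub_le hs).trans_lt hδε⟩,
    fun t ht t' ht' s hs s' hs' => hk.spinParam_eq_iff hδ hS hC ht ht' hs hs',
    hk.ambientIsotopic_image_spinParam hδ hS hC⟩

end IsHalfSpaceArc

/-! ### Surfaces of revolution -/

theorem mul_sq_lt_mul_sq {μ : ℝ → ℝ} {b ρ τ : ℝ} (hμ : 0 < μ ρ) (hmono : MonotoneOn μ (Ici b))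
    (hb : 0 ≤ b) (hρ : b ≤ ρ) (hρτ : ρ < τ) : ρ * μ ρ ^ 2 < τ * μ τ ^ 2 := by
  have hle := hmono hρ (hρ.trans hρτ.le) hρτ.le
  have hτ : 0 ≤ τ := hb.trans (hρ.trans hρτ.le)
  calc ρ * μ ρ ^ 2 < τ * μ ρ ^ 2 := by gcongr
    _ ≤ τ * μ τ ^ 2 := by gcongr

/-- From the parameter `b` on, the profile curve `τ ↦ (√τ * μ τ, F τ)` of a surface of revolution
moves away from the axis, beyond the distance of all earlier points. -/
def IsRecedingFrom (μ : ℝ → ℝ) (b : ℝ) : Prop :=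
  ∀ ⦃ρ τ : ℝ⦄, 0 ≤ ρ → ρ < τ → b ≤ τ → ρ * μ ρ ^ 2 < τ * μ τ ^ 2

namespace IsRecedingFrom

variable {μ ν : ℝ → ℝ} {b ρ τ : ℝ}

theorem mono {b' : ℝ} (h : IsRecedingFrom μ b) (hb : b ≤ b') : IsRecedingFrom μ b' :=
  fun _ _ hρ hρτ hτ => h hρ hρτ (hb.trans hτ)

theorem mul_sq_le (h : IsRecedingFrom μ b) (hb : 0 ≤ b) (hτ : b ≤ τ) :
    b * μ b ^ 2 ≤ τ * μ τ ^ 2 := by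
  rcases hτ.eq_or_lt with rfl | hlt
  exacts [le_rfl, (h hb hlt hτ).le]

theorem eq_or_lt (h : IsRecedingFrom μ b) (hρ : 0 ≤ ρ) (hτ : 0 ≤ τ)
    (heq : ρ * μ ρ ^ 2 = τ * μ τ ^ 2) : ρ = τ ∨ (ρ < b ∧ τ < b) := by
  rcases lt_trichotomy ρ τ with hlt | rfl | hlt
  · have hτb : τ < b := lt_of_not_ge fun hle => (h hρ hlt hle).ne heq
    exact .inr ⟨hlt.trans hτb, hτb⟩
  · exact .inl rfl
  · have hρb : ρ < b := lt_of_not_ge fun hle => (h hτ hlt hle).ne' heq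
    exact .inr ⟨hρb, hlt.trans hρb⟩

theorem congr (h : IsRecedingFrom μ b) (hb : 0 ≤ b) (hν : ∀ τ, 0 < ν τ) (heq : EqOn μ ν (Iic b))
    (hmono : MonotoneOn ν (Ici b)) : IsRecedingFrom ν b := by
  intro ρ τ hρ hρτ hτ
  rcases le_or_gt b ρ with hbρ | hρb
  · exact mul_sq_lt_mul_sq (hν ρ) hmono hb hbρ hρτ
  calc ρ * ν ρ ^ 2 = ρ * μ ρ ^ 2 := by rw [heq hρb.le]
    _ < b * μ b ^ 2 := h hρ hρb le_rfl
    _ = b * ν b ^ 2 := by rw [heq self_mem_Iic]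
    _ ≤ τ * ν τ ^ 2 := by
      have hle := hmono self_mem_Ici hτ hτ
      have hpos := hν b
      have hτ₀ := hb.trans hτ
      gcongr

end IsRecedingFrom

theorem exists_isRecedingFrom {μ : ℝ → ℝ} {b : ℝ} (hμ : Continuous μ) (hpos : ∀ τ, 0 < μ τ)
    (hb : 0 ≤ b) (hmono : MonotoneOn μ (Ici b)) : ∃ c, b ≤ c ∧ IsRecedingFrom μ c := by
  obtain ⟨B, hB⟩ := (isCompact_Icc (a := (0 : ℝ)) (b := b)).bddAbove_image
    (f := fun τ => τ * μ τ ^ 2) (by fun_prop)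
  obtain ⟨c, hBc, hbc⟩ := (((tendsto_mul_sq_atTop tendsto_id (hpos b) hmono).eventually_gt_atTop
    B).and (eventually_ge_atTop b)).exists
  refine ⟨c, hbc, fun ρ τ hρ hρτ hτ => ?_⟩
  rcases le_or_gt b ρ with hbρ | hρb
  · exact mul_sq_lt_mul_sq (hpos ρ) hmono hb hbρ hρτ
  calc ρ * μ ρ ^ 2 ≤ B := hB ⟨ρ, ⟨hρ, hρb.le⟩, rfl⟩
    _ < c * μ c ^ 2 := hBc
    _ ≤ τ * μ τ ^ 2 := by
      have hle := hmono hbc (hbc.trans hτ) hτ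
      have hpos := hpos c
      have h0 := hb.trans (hbc.trans hτ)
      gcongr

section Revolution

variable {V W : Type*} [NormedAddCommGroup V] [NormedSpace ℝ V]

/-- The surface of revolution that is swept out by the profile curve `τ ↦ (√τ * μ τ, F τ)`. The
parameter `τ` is the square of the distance from the origin, so that the surface is smooth, or
polynomial, whenever `μ` and `F` are. -/
def revolution (μ : ℝ → ℝ) (F : ℝ → W) (x : V) : V × W :=
  (μ (‖x‖ ^ 2) • x, F (‖x‖ ^ 2))

variable {μ ν : ℝ → ℝ} {F F' : ℝ → W} {b : ℝ}

theorem norm_smul_sq (x : V) : ‖μ (‖x‖ ^ 2) • x‖ ^ 2 = ‖x‖ ^ 2 * μ (‖x‖ ^ 2) ^ 2 := by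
  rw [norm_smul, mul_pow, Real.norm_eq_abs, sq_abs, mul_comm]

theorem mem_range_revolution_iff (hμ : ∀ τ, 0 < μ τ) {p : V × W} :
    p ∈ range (revolution μ F) ↔ ∃ τ, 0 ≤ τ ∧ ‖p.1‖ ^ 2 = τ * μ τ ^ 2 ∧ p.2 = F τ := by
  constructor
  · rintro ⟨x, rfl⟩
    exact ⟨‖x‖ ^ 2, by positivity, norm_smul_sq x, rfl⟩
  · rintro ⟨τ, -, hτ, hF⟩
    have hnorm : ‖(μ τ)⁻¹ • p.1‖ ^ 2 = τ := by
      rw [norm_smul, mul_pow, hτ, norm_inv, Real.norm_eq_abs, inv_pow, sq_abs]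
      field_simp [(hμ τ).ne']
    refine ⟨(μ τ)⁻¹ • p.1, Prod.ext ?_ ?_⟩
    · rw [revolution, hnorm, smul_inv_smul₀ (hμ τ).ne']
    · rw [revolution, hnorm, hF]

theorem injective_revolution (hμ : ∀ τ, 0 < μ τ)
    (hinj : InjOn (fun τ => (τ * μ τ ^ 2, F τ)) (Ici 0)) :
    Function.Injective (revolution (V := V) μ F) := by
  intro x y hxy
  obtain ⟨h₁, h₂⟩ := Prod.ext_iff.1 hxy
  have hnorm : ‖x‖ ^ 2 = ‖y‖ ^ 2 := by
    have hsq : ‖μ (‖x‖ ^ 2) • x‖ ^ 2 = ‖μ (‖y‖ ^ 2) • y‖ ^ 2 := congrArg (‖·‖ ^ 2) h₁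
    rw [norm_smul_sq, norm_smul_sq] at hsq
    exact hinj (sq_nonneg ‖x‖) (sq_nonneg ‖y‖) (Prod.ext hsq h₂)
  simp only [revolution, hnorm] at h₁
  exact smul_right_injective V (hμ _).ne' h₁

theorem isProperMap_smul_norm_sq [ProperSpace V] (hμ : Continuous μ)
    (hlim : Tendsto (fun τ => τ * μ τ ^ 2) atTop atTop) :
    IsProperMap fun x : V => μ (‖x‖ ^ 2) • x := by
  refine isProperMap_iff_tendsto_cocompact.2 ⟨by fun_prop, ?_⟩
  rw [← Metric.cobounded_eq_cocompact, ← tendsto_norm_atTop_iff_cobounded]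
  have hsq : Tendsto (fun x : V => ‖μ (‖x‖ ^ 2) • x‖ ^ 2) (Bornology.cobounded V) atTop := by
    simp only [norm_smul_sq]
    exact hlim.comp ((tendsto_pow_atTop two_ne_zero).comp tendsto_norm_cobounded_atTop)
  refine (Real.tendsto_sqrt_atTop.comp hsq).congr fun x => ?_
  exact Real.sqrt_sq (norm_nonneg _)

theorem isClosedEmbedding_revolution [ProperSpace V] [TopologicalSpace W] [T2Space W]
    (hμ : Continuous μ) (hF : Continuous F) (hinj : Function.Injective (revolution (V := V) μ F))
    (hlim : Tendsto (fun τ => τ * μ τ ^ 2) atTop atTop) :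
    IsClosedEmbedding (revolution (V := V) μ F) := by
  have hcont : Continuous (revolution (V := V) μ F) := by unfold revolution; fun_prop
  exact .of_continuous_injective_isClosedMap hcont hinj
    (isProperMap_of_comp_of_t2 hcont continuous_fst (isProperMap_smul_norm_sq hμ hlim)).isClosedMap

theorem ambientIsotopic_range_revolution [ProperSpace V] [NormedAddCommGroup W] [NormedSpace ℝ W]
    [FiniteDimensional ℝ W] (hμ : Continuous μ) (hF : Continuous F) (hF' : Continuous F')
    (hlim : Tendsto (fun τ => τ * μ τ ^ 2) atTop atTop) (hrec : IsRecedingFrom μ b)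
    (heq : EqOn F F' (Iic b)) :
    AmbientIsotopic (range (revolution (V := V) μ F)) (range (revolution μ F')) := by
  have hproper := isProperMap_smul_norm_sq (V := V) hμ hlim
  refine .range_prodMk hproper.continuous hproper.isClosedMap (by fun_prop) (by fun_prop) ?_
  intro x y hxy
  have hsq : ‖x‖ ^ 2 * μ (‖x‖ ^ 2) ^ 2 = ‖y‖ ^ 2 * μ (‖y‖ ^ 2) ^ 2 := by
    rw [← norm_smul_sq, ← norm_smul_sq, hxy]
  rcases hrec.eq_or_lt (sq_nonneg _) (sq_nonneg _) hsq with h | ⟨hx, hy⟩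
  · rw [h]
  · rw [← heq hx.le, ← heq hy.le, sub_self, sub_self]

theorem range_revolution_subset (hμ : ∀ τ, 0 < μ τ) (hν : ∀ τ, 0 < ν τ) (hνc : Continuous ν)
    (hb : 0 ≤ b) (hlim : Tendsto (fun τ => τ * ν τ ^ 2) atTop atTop) (hrec : IsRecedingFrom μ b)
    (heq : EqOn μ ν (Iic b)) {w : W} (hF : ∀ τ, b ≤ τ → F τ = w) :
    range (revolution (V := V) μ F) ⊆ range (revolution ν F) := by
  intro p hp
  obtain ⟨τ, hτ, hp₁, hp₂⟩ := (mem_range_revolution_iff hμ).1 hp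
  rw [mem_range_revolution_iff hν]
  rcases le_total τ b with hle | hle
  · exact ⟨τ, hτ, heq hle ▸ hp₁, hp₂⟩
  · obtain ⟨ρ, hρ, hρτ⟩ := isPreconnected_Ici.intermediate_value_Ici self_mem_Ici
      (le_principal_iff.2 (Ici_mem_atTop b)) (f := fun τ => τ * ν τ ^ 2) (by fun_prop) hlim
      ((heq self_mem_Iic ▸ hrec.mul_sq_le hb hle : b * ν b ^ 2 ≤ τ * μ τ ^ 2))
    exact ⟨ρ, hb.trans hρ, hp₁.trans hρτ.symm, by rw [hp₂, hF τ hle, hF ρ hρ]⟩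

end Revolution

section RegularProfile

variable {W : Type*} [NormedAddCommGroup W] [NormedSpace ℝ W]

/-- The profile curve `τ ↦ (√τ * μ τ, F τ)` sweeps out a smooth, properly embedded surface of
revolution. In `immersion`, `μ τ + 2 * τ * μ' τ` is `2 * √τ` times the derivative of `√τ * μ τ`. -/
structure IsRegularProfile (μ : ℝ → ℝ) (F : ℝ → W) : Prop where
  contDiff_left : ContDiff ℝ ∞ μ
  contDiff_right : ContDiff ℝ ∞ F
  pos : ∀ τ, 0 < μ τ
  injOn : InjOn (fun τ => (τ * μ τ ^ 2, F τ)) (Ici 0)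
  immersion : ∀ τ, 0 < τ → deriv F τ = 0 → μ τ + 2 * τ * deriv μ τ ≠ 0
  tendsto : Tendsto (fun τ => τ * μ τ ^ 2) atTop atTop

variable {V : Type*} [NormedAddCommGroup V] [InnerProductSpace ℝ V] {μ ν : ℝ → ℝ} {F F' : ℝ → W}
  {b c : ℝ}

theorem fderiv_revolution_apply {x : V} (hμ : DifferentiableAt ℝ μ (‖x‖ ^ 2))
    (hF : DifferentiableAt ℝ F (‖x‖ ^ 2)) (v : V) :
    fderiv ℝ (revolution μ F) x v =
      (μ (‖x‖ ^ 2) • v + (deriv μ (‖x‖ ^ 2) * (2 * inner ℝ x v)) • x,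
        (2 * inner ℝ x v) • deriv F (‖x‖ ^ 2)) := by
  have hsq := (hasStrictFDerivAt_norm_sq x).hasFDerivAt
  have h₁ := (hμ.hasDerivAt.comp_hasFDerivAt x hsq).smul (hasFDerivAt_id x)
  have h₂ := hF.hasDerivAt.hasFDerivAt.comp x hsq
  have h : HasFDerivAt (revolution μ F) _ x := h₁.prodMk h₂
  rw [h.fderiv]
  exact Prod.ext (by simp) (by simp [two_smul, two_mul, add_smul])

theorem monotoneOn_smoothTransition_interpolation {m : ℝ → ℝ} (hm : MonotoneOn m (Ici b)) :
    MonotoneOn (fun τ => (1 - Real.smoothTransition (τ - c)) * m τ +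
      Real.smoothTransition (τ - c) * m (c + 1)) (Ici b) := by
  intro s hs t ht hst
  have hone : ∀ r, c + 1 ≤ r → Real.smoothTransition (r - c) = 1 := fun r hr =>
    Real.smoothTransition.one_of_one_le (by linarith)
  dsimp only
  rcases le_total t (c + 1) with htc | htc
  · have hst' : m s ≤ m t := hm hs ht hst
    have htc' : m t ≤ m (c + 1) := hm ht (ht.trans htc) htc
    have hχ := Real.smoothTransition.monotone (sub_le_sub_right hst c)
    linarith [mul_nonneg (sub_nonneg.2 (Real.smoothTransition.le_one (t - c))) (sub_nonneg.2 hst'),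
      mul_nonneg (sub_nonneg.2 hχ) (sub_nonneg.2 (hst'.trans htc'))]
  rcases le_total s (c + 1) with hsc | hsc
  · have hsc' : m s ≤ m (c + 1) := hm hs (hs.trans hsc) hsc
    rw [hone t htc]
    linarith [mul_nonneg (sub_nonneg.2 (Real.smoothTransition.le_one (s - c))) (sub_nonneg.2 hsc')]
  · rw [hone t htc, hone s hsc]
    simp

namespace IsRegularProfile

theorem injective_fderiv_revolution (hp : IsRegularProfile μ F) (x : V) :
    Function.Injective (fderiv ℝ (revolution μ F) x) := by
  refine (injective_iff_map_eq_zero _).2 fun v hv => ?_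
  rw [fderiv_revolution_apply (hp.contDiff_left.differentiable (by simp) _)
    (hp.contDiff_right.differentiable (by simp) _), Prod.mk_eq_zero] at hv
  obtain ⟨hv₁, hv₂⟩ := hv
  have hinner : inner ℝ x v * (μ (‖x‖ ^ 2) + 2 * ‖x‖ ^ 2 * deriv μ (‖x‖ ^ 2)) = 0 := by
    have := congrArg (inner ℝ x) hv₁
    rw [inner_add_right, real_inner_smul_right, real_inner_smul_right, inner_zero_right,
      real_inner_self_eq_norm_sq] at this
    linear_combination this
  have horth : inner ℝ x v = 0 := by
    by_contra hne
    have hx : x ≠ 0 := by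
      rintro rfl
      exact hne (inner_zero_left v)
    exact hp.immersion _ (by positivity)
      ((smul_eq_zero.1 hv₂).resolve_left (mul_ne_zero two_ne_zero hne))
      ((mul_eq_zero.1 hinner).resolve_left hne)
  rw [horth, mul_zero, mul_zero, zero_smul, add_zero] at hv₁
  exact (smul_eq_zero.1 hv₁).resolve_left (hp.pos _).ne'

theorem contDiff_revolution (hp : IsRegularProfile μ F) :
    ContDiff ℝ ∞ (revolution (V := V) μ F) :=
  ((hp.contDiff_left.comp (contDiff_norm_sq ℝ)).smul contDiff_id).prodMk
    (hp.contDiff_right.comp (contDiff_norm_sq ℝ))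

theorem isClosedEmbedding_revolution [ProperSpace V] (hp : IsRegularProfile μ F) :
    IsClosedEmbedding (revolution (V := V) μ F) :=
  _root_.isClosedEmbedding_revolution hp.contDiff_left.continuous hp.contDiff_right.continuous
    (injective_revolution hp.pos hp.injOn) hp.tendsto

theorem congr (hp : IsRegularProfile μ F) (hb : 0 ≤ b) (hrec : IsRecedingFrom μ b)
    (hν : ContDiff ℝ ∞ ν) (hF' : ContDiff ℝ ∞ F') (hpos : ∀ τ, 0 < ν τ)
    (hμν : EqOn μ ν (Iic b)) (hFF' : EqOn F F' (Iic b)) (hmono : MonotoneOn ν (Ici b)) :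
    IsRegularProfile ν F' where
  contDiff_left := hν
  contDiff_right := hF'
  pos := hpos
  injOn := by
    intro ρ hρ τ hτ hρτ
    obtain ⟨h₁, h₂⟩ := Prod.ext_iff.1 hρτ
    refine ((hrec.congr hb hpos hμν hmono).eq_or_lt hρ hτ h₁).elim id fun ⟨hρb, hτb⟩ => ?_
    refine hp.injOn hρ hτ (Prod.ext ?_ ?_)
    · simpa only [hμν hρb.le, hμν hτb.le] using h₁
    · simpa only [hFF' hρb.le, hFF' hτb.le] using h₂
  immersion := by
    intro τ hτ hderiv
    rcases lt_or_ge τ b with hlt | hle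
    · have hnear : ∀ᶠ x in 𝓝 τ, x ≤ b := Iic_mem_nhds hlt
      rw [← EventuallyEq.deriv_eq (hnear.mono hFF')] at hderiv
      rw [← EventuallyEq.deriv_eq (hnear.mono hμν), ← hμν hlt.le]
      exact hp.immersion τ hτ hderiv
    · have hνderiv : 0 ≤ deriv ν τ := by
        rw [← (hν.differentiable (by simp) τ).derivWithin (uniqueDiffOn_Ici b τ hle)]
        exact hmono.derivWithin_nonneg
      have := hpos τ
      positivity
  tendsto := tendsto_mul_sq_atTop tendsto_id (hpos b) hmono

theorem exists_eventually_zero [ProperSpace V] [FiniteDimensional ℝ W]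
    (hp : IsRegularProfile μ F) (hb : 0 ≤ b) (hmono : MonotoneOn μ (Ici b)) :
    ∃ (F' : ℝ → W) (d : ℝ), b ≤ d ∧ IsRegularProfile μ F' ∧ IsRecedingFrom μ d ∧
      (∀ τ, d ≤ τ → F' τ = 0) ∧
      AmbientIsotopic (range (revolution (V := V) μ F)) (range (revolution μ F')) := by
  obtain ⟨d, hbd, hrec⟩ := exists_isRecedingFrom hp.contDiff_left.continuous hp.pos hb hmono
  have hF' : ContDiff ℝ ∞ fun τ => (1 - Real.smoothTransition (τ - d)) • F τ :=
    (contDiff_const.sub (Real.smoothTransition.contDiff.comp (contDiff_id.sub contDiff_const))).smul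
      hp.contDiff_right
  have heq : EqOn F (fun τ => (1 - Real.smoothTransition (τ - d)) • F τ) (Iic d) := fun τ hτ => by
    simp [Real.smoothTransition.zero_of_nonpos (sub_nonpos.2 hτ)]
  refine ⟨_, d + 1, by linarith, ?_, hrec.mono (by linarith), fun τ hτ => ?_,
    ambientIsotopic_range_revolution hp.contDiff_left.continuous hp.contDiff_right.continuous
      hF'.continuous hp.tendsto hrec heq⟩
  · exact hp.congr (hb.trans hbd) hrec hp.contDiff_left hF' hp.pos (eqOn_refl _ _) heq
      (hmono.mono (Ici_subset_Ici.2 hbd))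
  · simp [Real.smoothTransition.one_of_one_le (by linarith : 1 ≤ τ - d)]

theorem exists_eventually_const (hp : IsRegularProfile μ F) (hb : 0 ≤ b)
    (hmono : MonotoneOn μ (Ici b)) (hrec : IsRecedingFrom μ b) {w : W}
    (hF : ∀ τ, b ≤ τ → F τ = w) :
    ∃ (ν : ℝ → ℝ) (c : ℝ), 0 < c ∧ IsRegularProfile ν F ∧ (∀ᶠ τ in atTop, ν τ = c) ∧
      range (revolution (V := V) μ F) = range (revolution ν F) := by
  let χ : ℝ → ℝ := fun τ => Real.smoothTransition (τ - b)
  have hχ : ContDiff ℝ ∞ χ :=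
    Real.smoothTransition.contDiff.comp (contDiff_id.sub contDiff_const)
  let ν : ℝ → ℝ := fun τ => (1 - χ τ) * μ τ + χ τ * μ (b + 1)
  have hν : ContDiff ℝ ∞ ν :=
    ((contDiff_const.sub hχ).mul hp.contDiff_left).add (hχ.mul contDiff_const)
  have hpos : ∀ τ, 0 < ν τ := fun τ => (convex_Ioi (0 : ℝ)) (hp.pos τ) (hp.pos (b + 1))
    (sub_nonneg.2 (Real.smoothTransition.le_one _)) (Real.smoothTransition.nonneg _) (by ring)
  have hμν : EqOn μ ν (Iic b) := fun τ hτ => by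
    simp [ν, χ, Real.smoothTransition.zero_of_nonpos (sub_nonpos.2 hτ)]
  have hνmono : MonotoneOn ν (Ici b) := monotoneOn_smoothTransition_interpolation hmono
  have hpν : IsRegularProfile ν F := hp.congr hb hrec hν hp.contDiff_right hpos hμν
    (eqOn_refl _ _) hνmono
  refine ⟨ν, μ (b + 1), hp.pos _, hpν, ?_, ?_⟩
  · filter_upwards [eventually_ge_atTop (b + 1)] with τ hτ
    simp [ν, χ, Real.smoothTransition.one_of_one_le (by linarith : 1 ≤ τ - b)]
  · exact (range_revolution_subset hp.pos hpos hν.continuous hb hpν.tendsto hrec hμν hF).antisymm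
      (range_revolution_subset hpos hp.pos hp.contDiff_left.continuous hb hp.tendsto
        (hrec.congr hb hpos hμν hνmono) hμν.symm hF)

end IsRegularProfile

end RegularProfile

section Spun

variable {V : Type*} [NormedAddCommGroup V] [NormedSpace ℝ V] [ProperSpace V]

theorem ambientIsotopic_range_revolution_of_norm_snd {μ : ℝ → ℝ} (hμ : ∀ τ, 0 < μ τ) (F : ℝ → V) :
    AmbientIsotopic {p : V × V | ∃ τ, 0 ≤ τ ∧ p.1 = F τ ∧ ‖p.2‖ = τ * μ τ ^ 2}
      (range (revolution μ F)) := by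
  refine (AmbientIsotopic.image_rotate _).trans (AmbientIsotopic.symm ?_)
  convert AmbientIsotopic.image_norm_smul_fst (range (revolution (V := V) μ F)) using 1
  ext q
  constructor
  · rintro ⟨p, ⟨τ, hτ, hF, hnorm⟩, rfl⟩
    have hnorm' : ‖(√‖p.2‖)⁻¹ • -p.2‖ = √‖p.2‖ := by
      rw [norm_smul, norm_neg, norm_inv, Real.norm_of_nonneg (Real.sqrt_nonneg _), inv_mul_eq_div,
        Real.div_sqrt]
    refine ⟨((√‖p.2‖)⁻¹ • -p.2, p.1), ?_, Prod.ext ?_ rfl⟩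
    · rw [mem_range_revolution_iff hμ, hnorm', Real.sq_sqrt (norm_nonneg _)]
      exact ⟨τ, hτ, hnorm, hF⟩
    · rcases eq_or_ne p.2 0 with h₀ | h₀
      · simp [h₀]
      · simp only [hnorm']
        exact smul_inv_smul₀ (Real.sqrt_ne_zero'.2 (norm_pos_iff.2 h₀)) _
  · rintro ⟨p, hp, rfl⟩
    obtain ⟨τ, hτ, hnorm, hF⟩ := (mem_range_revolution_iff hμ).1 hp
    refine ⟨(p.2, -(‖p.1‖ • p.1)), ⟨τ, hτ, hF, ?_⟩, by simp⟩
    rw [norm_neg, norm_smul, norm_norm, ← sq, hnorm]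

end Spun

/-! ### Polynomial 2-knots -/

/-- The identification of `ℝ² × ℝ²` with `ℝ⁴` in which the first factor carries the first two
coordinates. -/
noncomputable def prodPlaneEquiv :
    (EuclideanSpace ℝ (Fin 2) × EuclideanSpace ℝ (Fin 2)) ≃L[ℝ] EuclideanSpace ℝ (Fin 4) :=
  (EuclideanSpace.finAddEquivProd (n := 2) (m := 2)).symm

theorem prodPlaneEquiv_apply (p : EuclideanSpace ℝ (Fin 2) × EuclideanSpace ℝ (Fin 2)) :
    prodPlaneEquiv p = !₂[p.1 0, p.1 1, p.2 0, p.2 1] := by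
  ext i
  fin_cases i <;> rfl

theorem spin_polyArc_eq_image (f g m : ℝ[X]) :
    spin (polyArc f g (X * m ^ 2) 0) =
      prodPlaneEquiv '' {p | ∃ τ, 0 ≤ τ ∧ p.1 = !₂[f.eval τ, g.eval τ] ∧
        ‖p.2‖ = τ * m.eval τ ^ 2} := by
  have hheight (τ : ℝ) : (X * m ^ 2).eval τ = τ * m.eval τ ^ 2 := by simp
  have hnonneg : ∀ p ∈ polyArc f g (X * m ^ 2) 0, 0 ≤ p 2 := by
    rintro _ ⟨τ, hτ, rfl⟩
    exact (hheight τ).ge.trans' (mul_nonneg hτ (sq_nonneg _))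
  ext q
  obtain ⟨p, rfl⟩ := prodPlaneEquiv.surjective q
  rw [mem_spin_iff hnonneg, prodPlaneEquiv.injective.mem_set_image, mem_ofPred_eq, polyArc,
    exists_mem_image]
  refine exists_congr fun τ => and_congr_right fun hτ => ?_
  rw [← sq_eq_sq₀ (norm_nonneg _) (mul_nonneg hτ (sq_nonneg _)), EuclideanSpace.real_norm_sq_eq,
    Fin.sum_univ_two, prodPlaneEquiv_apply, ← and_assoc, ← hheight]
  refine and_congr_left' ⟨fun h => ?_, fun h => ?_⟩
  · ext i
    fin_cases i
    exacts [h.1, h.2]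
  · simp [h, polyCurve]

variable {F : ℝ → EuclideanSpace ℝ (Fin 2)} {μ : ℝ → ℝ}

namespace IsRegularProfile

theorem isProperSmoothEmbedding_smul (hp : IsRegularProfile μ F) {c : ℝ} (hc : c ≠ 0) :
    IsProperSmoothEmbedding fun x => prodPlaneEquiv (revolution μ F (c • x)) where
  smooth := prodPlaneEquiv.contDiff.comp (hp.contDiff_revolution.comp (contDiff_const_smul c))
  immersion x := by
    have hd := (hp.contDiff_revolution (V := EuclideanSpace ℝ (Fin 2))).differentiable
      (by simp) (c • x)
    have hfderiv := (prodPlaneEquiv.hasFDerivAt.comp x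
      (hd.hasFDerivAt.comp x ((hasFDerivAt_id x).const_smul c))).fderiv
    simp only [Function.comp_def] at hfderiv
    rw [hfderiv]
    exact prodPlaneEquiv.injective.comp
      ((hp.injective_fderiv_revolution _).comp (smul_right_injective _ hc))
  proper := prodPlaneEquiv.toHomeomorph.isClosedEmbedding.comp
    (hp.isClosedEmbedding_revolution.comp (Homeomorph.smulOfNeZero c hc).isClosedEmbedding)

theorem isProperSmoothEmbedding (hp : IsRegularProfile μ F) :
    IsProperSmoothEmbedding fun x => prodPlaneEquiv (revolution μ F x) := by
  simpa using hp.isProperSmoothEmbedding_smul one_ne_zero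

theorem isLongTwoKnot (hp : IsRegularProfile μ F) {c : ℝ} (hc : 0 < c)
    (hev : ∀ᶠ τ in atTop, μ τ = c ∧ F τ = 0) :
    IsLongTwoKnot fun x => prodPlaneEquiv (revolution μ F (c⁻¹ • x)) where
  embedding := hp.isProperSmoothEmbedding_smul (inv_ne_zero hc.ne')
  standard := by
    have hnorm :
        Tendsto (fun x : EuclideanSpace ℝ (Fin 2) => ‖c⁻¹ • x‖ ^ 2) (cocompact _) atTop := by
      simp only [norm_smul]
      exact (tendsto_pow_atTop two_ne_zero).comp
        (tendsto_norm_cocompact_atTop.const_mul_atTop (norm_pos_iff.2 (inv_ne_zero hc.ne')))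
    obtain ⟨D, hD, hsub⟩ := mem_cocompact.1 (hnorm.eventually hev)
    refine ⟨D, hD, fun x hx => ?_⟩
    obtain ⟨hμ, hF⟩ := hsub hx
    simp [prodPlaneEquiv_apply, revolution, hμ, hF, hc.ne']

end IsRegularProfile

theorem eval_aeval_X_sq_add_X_sq (q : ℝ[X]) (x : EuclideanSpace ℝ (Fin 2)) :
    MvPolynomial.eval (fun j => x j)
      (aeval (MvPolynomial.X 0 ^ 2 + MvPolynomial.X 1 ^ 2 : MvPolynomial (Fin 2) ℝ) q) =
      q.eval (‖x‖ ^ 2) := by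
  rw [EuclideanSpace.real_norm_sq_eq, Fin.sum_univ_two]
  have h := Polynomial.aeval_algHom_apply (MvPolynomial.aeval (R := ℝ) fun j => x j)
    (MvPolynomial.X 0 ^ 2 + MvPolynomial.X 1 ^ 2) q
  simpa [coe_aeval_eq_eval, MvPolynomial.aeval_eq_eval] using h.symm

theorem exists_mvPolynomial_revolution (f g m : ℝ[X]) :
    ∃ p : Fin 4 → MvPolynomial (Fin 2) ℝ, ∀ x i,
      prodPlaneEquiv (revolution (fun τ => m.eval τ) (fun τ => !₂[f.eval τ, g.eval τ]) x) i =
        MvPolynomial.eval (fun j => x j) (p i) := by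
  let s : MvPolynomial (Fin 2) ℝ := MvPolynomial.X 0 ^ 2 + MvPolynomial.X 1 ^ 2
  refine ⟨![aeval s m * MvPolynomial.X 0, aeval s m * MvPolynomial.X 1, aeval s f, aeval s g],
    fun x i => ?_⟩
  fin_cases i <;> simp [prodPlaneEquiv_apply, revolution, s, eval_aeval_X_sq_add_X_sq]

theorem isPolynomialTwoKnot_revolution {f g m : ℝ[X]}
    (hp : IsRegularProfile (fun τ => m.eval τ) fun τ => !₂[f.eval τ, g.eval τ]) :
    IsPolynomialTwoKnot fun x => prodPlaneEquiv
      (revolution (fun τ => m.eval τ) (fun τ => !₂[f.eval τ, g.eval τ]) x) where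
  polynomial := exists_mvPolynomial_revolution f g m
  embedding := hp.isProperSmoothEmbedding
  long := by
    obtain ⟨b, hb, hmono⟩ := exists_monotoneOn_Ici_eval hp.pos
    obtain ⟨F, d, hbd, hpF, hrec, hF, hiso⟩ :=
      hp.exists_eventually_zero (V := EuclideanSpace ℝ (Fin 2)) hb hmono
    obtain ⟨ν, c, hc, hpν, hν, hrange⟩ :=
      hpF.exists_eventually_const (V := EuclideanSpace ℝ (Fin 2)) (hb.trans hbd)
        (hmono.mono (Ici_subset_Ici.2 hbd)) hrec hF
    refine ⟨_, hpν.isLongTwoKnot hc (hν.and (eventually_atTop.2 ⟨d, hF⟩)), ?_⟩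
    have hscale : range (fun x : EuclideanSpace ℝ (Fin 2) => revolution ν F (c⁻¹ • x)) =
        range (revolution ν F) :=
      (Homeomorph.smulOfNeZero c⁻¹ (inv_ne_zero hc.ne')).surjective.range_comp (revolution ν F)
    have := (hrange ▸ hiso).image_homeomorph prodPlaneEquiv.toHomeomorph
    rw [← hscale] at this
    simpa [← range_comp, Function.comp_def] using this

theorem contDiff_eval_pair (f g : ℝ[X]) : ContDiff ℝ ∞ fun τ => !₂[f.eval τ, g.eval τ] := by
  refine contDiff_euclidean.2 fun i => ?_
  fin_cases i
  exacts [f.contDiff_aeval ∞, g.contDiff_aeval ∞]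

theorem polyCurve_comp (f g h q : ℝ[X]) (t : ℝ) :
    polyCurve (f.comp q) (g.comp q) (h.comp q) t = polyCurve f g h (q.eval t) := by
  simp [polyCurve]

theorem polyArc_comp_X_add_C (f g h : ℝ[X]) (a : ℝ) :
    polyArc (f.comp (X + C a)) (g.comp (X + C a)) (h.comp (X + C a)) 0 = polyArc f g h a := by
  have hIci : Ici a = (· + a) '' Ici 0 := by simp
  simp only [polyArc, hIci, image_image, polyCurve_comp, eval_add, eval_X, eval_C]

namespace IsPolynomialKnot

variable {f g h m : ℝ[X]}

theorem comp_X_add_C (hK : IsPolynomialKnot f g h) (a : ℝ) :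
    IsPolynomialKnot (f.comp (X + C a)) (g.comp (X + C a)) (h.comp (X + C a)) where
  injective s t hst := by
    rw [polyCurve_comp, polyCurve_comp] at hst
    simpa using hK.injective hst
  immersion t := by
    simpa [derivative_comp, polyCurve_comp] using hK.immersion (t + a)

theorem isRegularProfile (hK : IsPolynomialKnot f g (X * m ^ 2)) (hm : ∀ t, 0 < m.eval t) :
    IsRegularProfile (fun τ => m.eval τ) fun τ => !₂[f.eval τ, g.eval τ] where
  contDiff_left := m.contDiff_aeval ∞
  contDiff_right := contDiff_eval_pair f g
  pos := hm
  injOn := by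
    intro s _ t _ hst
    obtain ⟨hh, hfg⟩ := Prod.ext_iff.1 hst
    exact hK.injective (polyCurve_eq_iff.2
      ⟨congrArg (· 0) hfg, congrArg (· 1) hfg, by simpa using hh⟩)
  immersion := by
    intro τ _ hF hμ
    rw [Polynomial.deriv] at hμ
    have hcoord (i : Fin 2) : HasDerivAt (fun τ => !₂[f.eval τ, g.eval τ] i) 0 τ := by
      have hdiff := (contDiff_eval_pair f g).differentiable (by simp) τ
      exact (EuclideanSpace.proj (𝕜 := ℝ) i).hasFDerivAt.comp_hasDerivAt τ
        (hF ▸ hdiff.hasDerivAt)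
    refine hK.immersion τ (polyCurve_eq_zero_iff.2
      ⟨(f.hasDerivAt τ).unique (hcoord 0), (g.hasDerivAt τ).unique (hcoord 1), ?_⟩)
    have hderiv : (derivative (X * m ^ 2)).eval τ =
        m.eval τ ^ 2 + τ * (2 * m.eval τ * (derivative m).eval τ) := by simp [derivative_pow]
    rw [hderiv]
    linear_combination m.eval τ * hμ
  tendsto := by
    obtain ⟨b, -, hmono⟩ := exists_monotoneOn_Ici_eval hm
    exact tendsto_mul_sq_atTop tendsto_id (hm b) hmono

end IsPolynomialKnot

theorem exists_isPolynomialTwoKnot {f g m : ℝ[X]} {a : ℝ} (hm : ∀ t, 0 < m.eval t)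
    (hK : IsPolynomialKnot f g ((X - C a) * m ^ 2)) :
    ∃ P, IsPolynomialTwoKnot P ∧
      AmbientIsotopic (spin (polyArc f g ((X - C a) * m ^ 2) a)) (range P) := by
  have hheight : ((X - C a) * m ^ 2).comp (X + C a) = X * m.comp (X + C a) ^ 2 := by simp
  have hm' : ∀ t, 0 < (m.comp (X + C a)).eval t := fun t => by simpa using hm (t + a)
  have hK' := hK.comp_X_add_C a
  rw [hheight] at hK'
  refine ⟨_, isPolynomialTwoKnot_revolution (hK'.isRegularProfile hm'), ?_⟩
  rw [← polyArc_comp_X_add_C, hheight, spin_polyArc_eq_image, range_comp' prodPlaneEquiv]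
  exact (ambientIsotopic_range_revolution_of_norm_snd hm' _).image_homeomorph
    prodPlaneEquiv.toHomeomorph

theorem theorem5 (f g h : ℝ[X]) (hK : IsPolynomialKnot f g h) :
    ∃ (f₁ g₁ h₁ : ℝ[X]) (a : ℝ) (P : EuclideanSpace ℝ (Fin 2) → EuclideanSpace ℝ (Fin 4)),
      -- the arc over `[a, ∞)` is a knotted arc of `K`, with one end at infinity
      IsKnottedArcOf f₁ g₁ h₁ a (range (polyCurve f g h)) ∧
      -- spinning it gives a polynomial 2-knot
      IsPolynomialTwoKnot P ∧
      AmbientIsotopic (spin (polyArc f₁ g₁ h₁ a)) (range P) ∧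
      -- which is parametrized with Chebyshev approximations of sine and cosine
      ∀ ε : ℝ, 0 < ε → ∃ N : ℕ, ∀ n : ℕ, N ≤ n → ∀ S C : ℝ[X],
        S = chebyshevApprox Real.sin 0 (2 * Real.pi) n →
        C = chebyshevApprox Real.cos 0 (2 * Real.pi) n →
        (∀ s ∈ Icc (0 : ℝ) (2 * Real.pi),
          |S.eval s - Real.sin s| < ε ∧ |C.eval s - Real.cos s| < ε) ∧
        -- the only identifications are those of the spinning construction
        (∀ t ∈ Ici a, ∀ t' ∈ Ici a, ∀ s ∈ Icc (0 : ℝ) (2 * Real.pi),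
          ∀ s' ∈ Icc (0 : ℝ) (2 * Real.pi),
          (spinParam f₁ g₁ h₁ S C (t, s) = spinParam f₁ g₁ h₁ S C (t', s') ↔
            t = t' ∧ (t = a ∨ s = s' ∨ (s = 0 ∧ s' = 2 * Real.pi) ∨
              (s = 2 * Real.pi ∧ s' = 0)))) ∧
        -- and the image is the spun surface, up to ambient isotopy
        AmbientIsotopic
          (spinParam f₁ g₁ h₁ S C '' (Ici a ×ˢ Icc (0 : ℝ) (2 * Real.pi)))
          (spin (polyArc f₁ g₁ h₁ a)) := by
  obtain ⟨f₁, g₁, m, a, hm, harc⟩ := hK.exists_isKnottedArcOf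
  obtain ⟨P, hP, hPiso⟩ := exists_isPolynomialTwoKnot hm harc.arc.knot
  exact ⟨f₁, g₁, (X - C a) * m ^ 2, a, P, harc, hP, hPiso,
    fun ε hε => harc.arc.spinParam_chebyshevApprox hε⟩
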